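/- Let $A$ be an associative ring with unit (the zero ring is allowed). The reduced endomorphism class group $\widetilde{\mathrm{End}}_0(A)$ is the abelian group with one generator $[A^n,\alpha]$ for each isomorphism class of pairs $(A^n,\alpha)$, where $n\ge 0$ and $\alpha$ is an endomorphism of the free left $A$-module $A^n$, and with the relations $[A^n,\alpha]+[A^{n''},\alpha'']=[A^{n'},\alpha']$ whenever there is an exact sequence $0\to(A^n,\alpha)\to(A^{n'},\alpha')\to(A^{n''},\alpha'')\to0$, and $[A,0]=0$. Let $A[x]$ be the polynomial ring in a central indeterminate, let $\epsilon:A[x]\to A$, $x\mapsto 0$, and let $\Sigma$ be the set of all square matrices $\sigma$ over $A[x]$ such that $\epsilon(\sigma)$ is invertible. Let $i_\Sigma:A[x]\to B=\Sigma^{-1}A[x]$ be Cohn's universal localization, i.e. the universal ring homomorphism making every matrix in $\Sigma$ invertible, and let $\epsilon_\Sigma:B\to A$ be the homomorphism with $\epsilon_\Sigma i_\Sigma=\epsilon$. Every $b\in B$ with $\epsilon_\Sigma(b)=1$ is a unit, so $\epsilon_\Sigma^{-1}(1)$ is a group under multiplication. Let $C\subset\epsilon_\Sigma^{-1}(1)$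 be the (normal) subgroup generated by $$\{(1+ab)(1+ba)^{-1}\mid a,b\in B,\ \epsilon_\Sigma(ab)=\epsilon_\Sigma(ba)=0\}.$$ For an $n\times n$ matrix $\alpha$ over $B$ with $\epsilon_\Sigma(\alpha)=1$ define $D(\alpha)\in\epsilon_\Sigma^{-1}(1)/C$ recursively: $D(\alpha)=1$ if $n=0$, $D(\alpha)$ is the class of $\alpha$ if $n=1$, and, if $n\ge2$, $$D(\alpha)=\alpha_{11}\,D\bigl(\alpha_{22}-\alpha_{21}\alpha_{11}^{-1}\alpha_{12}\bigr),$$ where $\alpha=\begin{pmatrix}\alpha_{11}&\alpha_{12}\\ \alpha_{21}&\alpha_{22}\end{pmatrix}$ with $\alpha_{11}\in B$ the top left entry. Theorem. There is a group isomorphism $$\widetilde{\mathrm{End}}_0(A)\;\cong\;\epsilon_\Sigma^{-1}(1)/C,\qquad [A^n,\alpha]\mapsto D(1-\alpha x),$$ where $\alpha$ is identified with the $n\times n$ matrix over $A$ whose $i$-th row is $\alpha(e_i)$, and $1-\alpha x$ is regarded as a matrix over $B$ via $i_\Sigma$. -/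

import Mathlib

/-! ### Universal localization

For a ring homomorphism `f : R → A`, the ring obtained from `R` by universally adjoining an inverse
to every square matrix over `R` that becomes invertible over `A`. -/

namespace UniversalLocalization

variable {R A : Type*} [Ring R] [Ring A]

/-- The set `Σ` of square matrices over `R` (of any size) whose image over `A` is invertible. -/
def InvertedMatrix (f : R →+* A) : Type _ :=
  Σ n : ℕ, {σ : Matrix (Fin n) (Fin n) R // IsUnit (f.mapMatrix σ)}

/-- Generators of `Σ⁻¹R`: the elements of `R` and, for each `σ ∈ Σ`, the entries of a formal
inverse of `σ`. -/
inductive Gen (f : R →+* A) : Type _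
  | of (r : R) : Gen f
  | inv (σ : InvertedMatrix f) (i j : Fin σ.1) : Gen f

/-- The free ring on the generators. -/
abbrev FreeRing (f : R →+* A) : Type _ := FreeAlgebra ℤ (Gen f)

/-- The generator belonging to `r : R`. -/
def genOf (f : R →+* A) (r : R) : FreeRing f := FreeAlgebra.ι ℤ (Gen.of r)

/-- The `(i, j)` entry of the formal inverse of `σ`. -/
def genInv (f : R →+* A) (σ : InvertedMatrix f) (i j : Fin σ.1) : FreeRing f :=
  FreeAlgebra.ι ℤ (Gen.inv σ i j)

/-- Defining relations: those of the ring `R`, and `σ σ⁻¹ = 1 = σ⁻¹ σ` for all `σ ∈ Σ`. -/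
inductive Rel (f : R →+* A) : FreeRing f → FreeRing f → Prop
  | one : Rel f (genOf f 1) 1
  | add (r s : R) : Rel f (genOf f (r + s)) (genOf f r + genOf f s)
  | mul (r s : R) : Rel f (genOf f (r * s)) (genOf f r * genOf f s)
  | mul_inv (σ : InvertedMatrix f) (i j : Fin σ.1) :
      Rel f (∑ k, genOf f (σ.2.1 i k) * genInv f σ k j) (if i = j then 1 else 0)
  | inv_mul (σ : InvertedMatrix f) (i j : Fin σ.1) :
      Rel f (∑ k, genInv f σ i k * genOf f (σ.2.1 k j)) (if i = j then 1 else 0)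

/-- The universal localization `Σ⁻¹R`. -/
def Loc (f : R →+* A) : Type _ := RingQuot (Rel f)

noncomputable instance (f : R →+* A) : Ring (Loc f) := inferInstanceAs (Ring (RingQuot (Rel f)))

/-- The quotient map from the free ring. -/
noncomputable def quot (f : R →+* A) : FreeRing f →+* Loc f := RingQuot.mkRingHom (Rel f)

/-- The canonical map `i_Σ : R → Σ⁻¹R`. -/
noncomputable def incl (f : R →+* A) : R →+* Loc f where
  toFun r := quot f (genOf f r)
  map_one' := (RingQuot.mkRingHom_rel Rel.one).trans (map_one _)
  map_mul' r s := (RingQuot.mkRingHom_rel (Rel.mul r s)).trans (map_mul _ _ _)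
  map_add' r s := (RingQuot.mkRingHom_rel (Rel.add r s)).trans (map_add _ _ _)
  map_zero' := by
    have h : quot f (genOf f (0 + 0)) = quot f (genOf f 0) + quot f (genOf f 0) :=
      (RingQuot.mkRingHom_rel (Rel.add 0 0)).trans (map_add _ _ _)
    rw [add_zero] at h
    exact left_eq_add.mp h

/-- The inverse over `Σ⁻¹R` of `σ ∈ Σ`. -/
noncomputable def invMatrix (f : R →+* A) (σ : InvertedMatrix f) :
    Matrix (Fin σ.1) (Fin σ.1) (Loc f) :=
  Matrix.of fun i j => quot f (genInv f σ i j)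

theorem mul_invMatrix (f : R →+* A) (σ : InvertedMatrix f) :
    (incl f).mapMatrix σ.2.1 * invMatrix f σ = 1 := by
  ext i j
  have h := RingQuot.mkRingHom_rel (Rel.mul_inv σ i j)
  change quot f _ = quot f _ at h
  rw [map_sum] at h
  simp only [map_mul] at h
  rw [Matrix.mul_apply, Matrix.one_apply]
  refine Eq.trans ?_ (h.trans ?_)
  · rfl
  · split_ifs <;> simp

theorem invMatrix_mul (f : R →+* A) (σ : InvertedMatrix f) :
    invMatrix f σ * (incl f).mapMatrix σ.2.1 = 1 := by
  ext i j
  have h := RingQuot.mkRingHom_rel (Rel.inv_mul σ i j)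
  change quot f _ = quot f _ at h
  rw [map_sum] at h
  simp only [map_mul] at h
  rw [Matrix.mul_apply, Matrix.one_apply]
  refine Eq.trans ?_ (h.trans ?_)
  · rfl
  · split_ifs <;> simp

/-- `i_Σ` inverts every matrix of `Σ`. -/
theorem isUnit_incl (f : R →+* A) {n : ℕ} (σ : Matrix (Fin n) (Fin n) R)
    (h : IsUnit (f.mapMatrix σ)) : IsUnit ((incl f).mapMatrix σ) :=
  ⟨⟨_, _, mul_invMatrix f ⟨n, σ, h⟩, invMatrix_mul f ⟨n, σ, h⟩⟩, rfl⟩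

section lift

variable {S : Type*} [Ring S]

/-- Values of a `Σ`-inverting homomorphism `g` on the generators. -/
noncomputable def liftGen (f : R →+* A) (g : R →+* S)
    (hg : ∀ σ : InvertedMatrix f, IsUnit (g.mapMatrix σ.2.1)) : Gen f → S
  | Gen.of r => g r
  | Gen.inv σ i j => (((hg σ).unit⁻¹ : (Matrix (Fin σ.1) (Fin σ.1) S)ˣ) :
      Matrix (Fin σ.1) (Fin σ.1) S) i j

/-- The universal property: a `Σ`-inverting homomorphism factors through `Σ⁻¹R`. -/
noncomputable def lift (f : R →+* A) (g : R →+* S)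
    (hg : ∀ σ : InvertedMatrix f, IsUnit (g.mapMatrix σ.2.1)) : Loc f →+* S :=
  RingQuot.lift ⟨(FreeAlgebra.lift ℤ (liftGen f g hg) : FreeRing f →ₐ[ℤ] S).toRingHom, by
    intro x y h
    change FreeAlgebra.lift ℤ (liftGen f g hg) x = FreeAlgebra.lift ℤ (liftGen f g hg) y
    cases h with
    | one => simp [genOf, liftGen]
    | add r s => simp [genOf, liftGen]
    | mul r s => simp [genOf, liftGen]
    | mul_inv σ i j =>
      have h := congrFun (congrFun (hg σ).mul_val_inv i) j
      rw [Matrix.mul_apply, Matrix.one_apply] at h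
      simp only [map_sum, map_mul, genOf, genInv, FreeAlgebra.lift_ι_apply, liftGen]
      refine Eq.trans ?_ (h.trans ?_)
      · rfl
      · split_ifs <;> simp
    | inv_mul σ i j =>
      have h := congrFun (congrFun (hg σ).val_inv_mul i) j
      rw [Matrix.mul_apply, Matrix.one_apply] at h
      simp only [map_sum, map_mul, genOf, genInv, FreeAlgebra.lift_ι_apply, liftGen]
      refine Eq.trans ?_ (h.trans ?_)
      · rfl
      · split_ifs <;> simp⟩

theorem lift_incl (f : R →+* A) (g : R →+* S)
    (hg : ∀ σ : InvertedMatrix f, IsUnit (g.mapMatrix σ.2.1)) (r : R) :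
    lift f g hg (incl f r) = g r := by
  change RingQuot.lift _ (RingQuot.mkRingHom _ _) = _
  rw [RingQuot.lift_mkRingHom_apply]
  change FreeAlgebra.lift ℤ (liftGen f g hg) (FreeAlgebra.ι ℤ (Gen.of r)) = _
  rw [FreeAlgebra.lift_ι_apply]
  rfl

/-- The factorization through `Σ⁻¹R` is unique. -/
theorem hom_ext (f : R →+* A) {g h : Loc f →+* S} (H : ∀ r, g (incl f r) = h (incl f r)) :
    g = h := by
  have hM : ∀ σ : InvertedMatrix f,
      g.mapMatrix (invMatrix f σ) = h.mapMatrix (invMatrix f σ) := by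
    intro σ
    have e : g.mapMatrix ((incl f).mapMatrix σ.2.1) = h.mapMatrix ((incl f).mapMatrix σ.2.1) := by
      ext i j
      exact H _
    have h1 := congrArg g.mapMatrix (invMatrix_mul f σ)
    have h2 := congrArg h.mapMatrix (mul_invMatrix f σ)
    rw [map_mul, map_one] at h1 h2
    rw [← e] at h2
    exact left_inv_eq_right_inv h1 h2
  refine RingQuot.ringQuot_ext g h (RingHom.ext fun x => ?_)
  change g (quot f x) = h (quot f x)
  induction x using FreeAlgebra.induction with
  | grade0 n => simp
  | grade1 x =>
    cases x with
    | of r => exact H r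
    | inv σ i j => exact congrFun (congrFun (hM σ) i) j
  | mul a b ha hb => rw [map_mul, map_mul, map_mul, ha, hb]
  | add a b ha hb => rw [map_add, map_add, map_add, ha, hb]

end lift

/-- The induced homomorphism `f_Σ : Σ⁻¹R → A`, characterized by `f_Σ ∘ i_Σ = f`. -/
noncomputable def aug (f : R →+* A) : Loc f →+* A := lift f f fun σ => σ.2.2

@[simp]
theorem aug_incl (f : R →+* A) (r : R) : aug f (incl f r) = f r := lift_incl f f _ r

/-! #### Every element of `Σ⁻¹R` that becomes invertible in `A` is invertible -/

theorem isUnit_incl' (f : R →+* A) {κ : Type} [Fintype κ] [DecidableEq κ] (σ : Matrix κ κ R)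
    (h : IsUnit (f.mapMatrix σ)) : IsUnit ((incl f).mapMatrix σ) := by
  let e := Fintype.equivFin κ
  have h1 : IsUnit (f.mapMatrix (Matrix.reindexRingEquiv R e σ)) :=
    h.map (Matrix.reindexRingEquiv A e)
  have h2 := (isUnit_incl f _ h1).map (Matrix.reindexRingEquiv (Loc f) e.symm)
  have h3 : Matrix.reindexRingEquiv (Loc f) e.symm
      ((incl f).mapMatrix (Matrix.reindexRingEquiv R e σ)) = (incl f).mapMatrix σ := by
    ext i j
    simp [Matrix.reindexRingEquiv]
  rwa [h3] at h2

/-- `b = v w` where `w` solves a linear system `s w = u` with `s ∈ Σ`. -/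
def Solves (f : R →+* A) (b : Loc f) : Prop :=
  ∃ (κ : Type) (_ : Fintype κ) (_ : DecidableEq κ) (s : Matrix κ κ R)
    (u : Matrix κ Unit R) (v : Matrix Unit κ R) (w : Matrix κ Unit (Loc f)),
    IsUnit (f.mapMatrix s) ∧ s.map (incl f) * w = u.map (incl f) ∧
      v.map (incl f) * w = Matrix.of fun _ _ => b

theorem isUnit_fromBlocks {S : Type*} [Ring S] {κ l : Type} [Fintype κ] [DecidableEq κ]
    [Fintype l] [DecidableEq l] {a : Matrix κ κ S} {d : Matrix l l S} (ha : IsUnit a)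
    (hd : IsUnit d) (b : Matrix κ l S) : IsUnit (Matrix.fromBlocks a b 0 d) := by
  obtain ⟨a, rfl⟩ := ha
  obtain ⟨d, rfl⟩ := hd
  have h1 : Matrix.fromBlocks a.1 b 0 d.1 *
      Matrix.fromBlocks (a⁻¹).1 (-((a⁻¹).1 * b * (d⁻¹).1)) 0 (d⁻¹).1 = 1 := by
    rw [Matrix.fromBlocks_multiply]
    simp [← Matrix.mul_assoc]
  have h2 : Matrix.fromBlocks (a⁻¹).1 (-((a⁻¹).1 * b * (d⁻¹).1)) 0 (d⁻¹).1 *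
      Matrix.fromBlocks a.1 b 0 d.1 = 1 := by
    rw [Matrix.fromBlocks_multiply]
    simp [Matrix.mul_assoc]
  exact ⟨⟨_, _, h1, h2⟩, rfl⟩

theorem isUnit_fromBlocks' {S : Type*} [Ring S] {κ l : Type} [Fintype κ] [DecidableEq κ]
    [Fintype l] [DecidableEq l] {a : Matrix κ κ S} {d : Matrix l l S} (ha : IsUnit a)
    (hd : IsUnit d) (c : Matrix l κ S) : IsUnit (Matrix.fromBlocks a 0 c d) := by
  obtain ⟨a, rfl⟩ := ha
  obtain ⟨d, rfl⟩ := hd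
  have h1 : Matrix.fromBlocks a.1 0 c d.1 *
      Matrix.fromBlocks (a⁻¹).1 0 (-((d⁻¹).1 * c * (a⁻¹).1)) (d⁻¹).1 = 1 := by
    rw [Matrix.fromBlocks_multiply]
    simp [← Matrix.mul_assoc]
  have h2 : Matrix.fromBlocks (a⁻¹).1 0 (-((d⁻¹).1 * c * (a⁻¹).1)) (d⁻¹).1 *
      Matrix.fromBlocks a.1 0 c d.1 = 1 := by
    rw [Matrix.fromBlocks_multiply]
    simp [Matrix.mul_assoc]
  exact ⟨⟨_, _, h1, h2⟩, rfl⟩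

theorem solves_incl (f : R →+* A) (r : R) : Solves f (incl f r) := by
  refine ⟨Unit, inferInstance, inferInstance, 1, Matrix.of fun _ _ => r, 1,
    Matrix.of fun _ _ => incl f r, by simp, ?_, ?_⟩
  · rw [Matrix.map_one _ (map_zero _) (map_one _), Matrix.one_mul]
    rfl
  · rw [Matrix.map_one _ (map_zero _) (map_one _), Matrix.one_mul]

theorem solves_inv (f : R →+* A) (σ : InvertedMatrix f) (i j : Fin σ.1) :
    Solves f (invMatrix f σ i j) := by
  refine ⟨Fin σ.1, inferInstance, inferInstance, σ.2.1,
    Matrix.of fun k _ => (1 : Matrix _ _ R) k j, Matrix.of fun _ k => (1 : Matrix _ _ R) i k,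
    Matrix.of fun k _ => invMatrix f σ k j, σ.2.2, ?_, ?_⟩
  · ext k l
    have h := congrFun (congrFun (mul_invMatrix f σ) k) j
    refine Eq.trans ?_ (h.trans ?_)
    · rfl
    · simp [Matrix.one_apply, apply_ite (incl f)]
  · ext k l
    simp [Matrix.mul_apply, Matrix.one_apply, apply_ite (incl f)]

theorem Solves.add {f : R →+* A} {b b' : Loc f} (h : Solves f b) (h' : Solves f b') :
    Solves f (b + b') := by
  obtain ⟨κ, _, _, s, u, v, w, hs, h1, h2⟩ := h
  obtain ⟨l, _, _, s', u', v', w', hs', h1', h2'⟩ := h'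
  refine ⟨κ ⊕ l, inferInstance, inferInstance, Matrix.fromBlocks s 0 0 s', Matrix.fromRows u u',
    Matrix.fromCols v v', Matrix.fromRows w w', ?_, ?_, ?_⟩
  · have := isUnit_fromBlocks hs hs' 0
    rw [RingHom.mapMatrix_apply, Matrix.fromBlocks_map]
    simpa using this
  · rw [Matrix.fromBlocks_map, Matrix.fromBlocks_mul_fromRows]
    simp only [Matrix.map_zero _ (map_zero (incl f)), Matrix.zero_mul, h1, h1']
    ext (i | i) j <;> simp
  · have : (Matrix.fromCols v v').map (incl f) =
        Matrix.fromCols (v.map (incl f)) (v'.map (incl f)) := by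
      ext i (j | j) <;> simp
    rw [this, Matrix.fromCols_mul_fromRows, h2, h2']
    rfl

theorem Solves.mul {f : R →+* A} {b b' : Loc f} (h : Solves f b) (h' : Solves f b') :
    Solves f (b * b') := by
  obtain ⟨κ, _, _, s, u, v, w, hs, h1, h2⟩ := h
  obtain ⟨l, _, _, s', u', v', w', hs', h1', h2'⟩ := h'
  let c : Matrix Unit Unit (Loc f) := Matrix.of fun _ _ => b'
  let wc : Matrix κ Unit (Loc f) := w * c
  refine ⟨κ ⊕ l, inferInstance, inferInstance, Matrix.fromBlocks s (-(u * v')) 0 s',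
    Matrix.fromRows 0 u', Matrix.fromCols v 0, Matrix.fromRows wc w', ?_, ?_, ?_⟩
  · have := isUnit_fromBlocks hs hs' ((-(u * v')).map f)
    rw [RingHom.mapMatrix_apply, Matrix.fromBlocks_map, Matrix.map_zero _ (map_zero f)]
    exact this
  · have hn : (-(u * v')).map (incl f) = -(u.map (incl f) * v'.map (incl f)) := by
      rw [← Matrix.map_mul]
      ext i j
      exact map_neg (incl f) _
    have hc : s.map (incl f) * wc = u.map (incl f) * c := by
      rw [← h1, Matrix.mul_assoc]
    rw [Matrix.fromBlocks_map, Matrix.fromBlocks_mul_fromRows, hn, hc, h1',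
      Matrix.neg_mul, Matrix.mul_assoc, h2', Matrix.map_zero _ (map_zero (incl f))]
    ext (i | i) j <;> simp [c]
  · have : (Matrix.fromCols v (0 : Matrix Unit l R)).map (incl f) =
        Matrix.fromCols (v.map (incl f)) 0 := by
      ext i (j | j) <;> simp
    have hc : v.map (incl f) * wc = (Matrix.of fun _ _ => b) * c := by
      rw [← h2, Matrix.mul_assoc]
    rw [this, Matrix.fromCols_mul_fromRows, hc]
    ext i j
    simp [Matrix.mul_apply, c]

theorem solves (f : R →+* A) (b : Loc f) : Solves f b := by
  obtain ⟨x, rfl⟩ : ∃ x, quot f x = b := RingQuot.mkRingHom_surjective _ b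
  induction x using FreeAlgebra.induction with
  | grade0 n =>
    have h := solves_incl f (n : R)
    rw [map_intCast] at h
    simpa using h
  | grade1 x =>
    cases x with
    | of r => exact solves_incl f r
    | inv σ i j => exact solves_inv f σ i j
  | mul a b ha hb => rw [map_mul]; exact ha.mul hb
  | add a b ha hb => rw [map_add]; exact ha.add hb

instance isLocalHom_aug (f : R →+* A) : IsLocalHom (aug f) where
  map_nonunit b hb := by
    obtain ⟨κ, _, _, s, u, v, w, hs, h1, h2⟩ := solves f b
    let M : Matrix (κ ⊕ Unit) (κ ⊕ Unit) R := Matrix.fromBlocks s u (-v) 0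
    let T : Matrix (κ ⊕ Unit) (κ ⊕ Unit) (Loc f) := Matrix.fromBlocks 1 (-w) 0 1
    let L : Matrix (κ ⊕ Unit) (κ ⊕ Unit) (Loc f) :=
      Matrix.fromBlocks (s.map (incl f)) 0 (-v.map (incl f)) (Matrix.of fun _ _ => b)
    have hT : IsUnit T := isUnit_fromBlocks isUnit_one isUnit_one _
    have hMT : (incl f).mapMatrix M * T = L := by
      have hv : (-v).map (incl f) = -v.map (incl f) := by
        ext i j
        simp
      rw [RingHom.mapMatrix_apply, Matrix.fromBlocks_map, Matrix.fromBlocks_multiply, hv]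
      simp [h1, h2, L]
    have hfM : (aug f).mapMatrix ((incl f).mapMatrix M) = f.mapMatrix M := by
      ext i j
      simp
    have hL : IsUnit ((aug f).mapMatrix L) := by
      have hb' : IsUnit (Matrix.of fun _ _ => aug f b : Matrix Unit Unit A) := by
        obtain ⟨β, hβ⟩ := hb
        refine ⟨⟨_, Matrix.of fun _ _ => (β⁻¹).1, ?_, ?_⟩, rfl⟩ <;>
        · ext i j
          simp [Matrix.mul_apply, ← hβ]
      have hs' : (s.map (incl f)).map (aug f) = f.mapMatrix s := by
        ext i j
        simp
      have h := isUnit_fromBlocks' hs hb' ((-v.map (incl f)).map (aug f))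
      rw [RingHom.mapMatrix_apply, Matrix.fromBlocks_map, Matrix.map_zero _ (map_zero _), hs']
      exact h
    have hM : IsUnit (f.mapMatrix M) := by
      rw [← hMT, map_mul, hfM] at hL
      obtain ⟨t, ht⟩ := hT.map (aug f).mapMatrix
      rw [← ht] at hL
      exact (Units.isUnit_mul_units _ t).mp hL
    have hLu : IsUnit L := hMT ▸ (isUnit_incl' f M hM).mul hT
    obtain ⟨⟨L₁, L₂, h12, h21⟩, rfl : L₁ = L⟩ := hLu
    have hsu : IsUnit (s.map (incl f)) := isUnit_incl' f s hs
    rw [← Matrix.fromBlocks_toBlocks L₂] at h12 h21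
    rw [Matrix.fromBlocks_multiply, ← Matrix.fromBlocks_one, Matrix.fromBlocks_inj] at h12 h21
    obtain ⟨-, e1, -, e2⟩ := h12
    obtain ⟨-, -, -, e3⟩ := h21
    rw [Matrix.zero_mul, add_zero] at e1
    have e4 : L₂.toBlocks₁₂ = 0 := by
      obtain ⟨q, hq⟩ := hsu
      rw [← hq] at e1
      have := congrArg (fun z => (q⁻¹).1 * z) e1
      simpa [← Matrix.mul_assoc] using this
    rw [e4, Matrix.mul_zero, zero_add] at e2
    rw [Matrix.mul_zero, zero_add] at e3
    have e2' := congrFun (congrFun e2 ()) ()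
    have e3' := congrFun (congrFun e3 ()) ()
    simp only [Matrix.mul_apply, Finset.univ_unique, Finset.sum_singleton, Matrix.of_apply,
      Matrix.one_apply_eq] at e2' e3'
    exact ⟨⟨b, _, e2', e3'⟩, rfl⟩

end UniversalLocalization

/-! ### The group `ε⁻¹(1)`, its subgroup `C`, and the Dieudonné-type determinant `D` -/

namespace LocalAugmentation

variable {B A : Type*} [Ring B] [Ring A]

/-- The multiplicative group `ε⁻¹(1)`. Its elements are units of `B`; when `ε` is local this is no
restriction, see `ofOne`. -/
abbrev OneFiber (ε : B →+* A) : Subgroup Bˣ := (Units.map (ε : B →* A)).ker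

/-- For `ε` local, every `b` with `ε b = 1` is an element of the group `ε⁻¹(1)`. -/
noncomputable def ofOne (ε : B →+* A) [IsLocalHom ε] (b : B) (h : ε b = 1) : OneFiber ε :=
  ⟨(IsUnit.of_map ε b (h ▸ isUnit_one)).unit, Units.ext h⟩

@[simp]
theorem coe_ofOne (ε : B →+* A) [IsLocalHom ε] (b : B) (h : ε b = 1) :
    ((ofOne ε b h : Bˣ) : B) = b := rfl

/-- The set of all `(1 + ab)(1 + ba)⁻¹` with `a, b ∈ B` and `ε(ab) = ε(ba) = 0`. -/
def commSet (ε : B →+* A) : Set (OneFiber ε) :=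
  {g | ∃ a b : B, ε (a * b) = 0 ∧ ε (b * a) = 0 ∧ ∃ p q : OneFiber ε,
    ((p : Bˣ) : B) = 1 + a * b ∧ ((q : Bˣ) : B) = 1 + b * a ∧ g = p * q⁻¹}

/-- The subgroup `C` of `ε⁻¹(1)`. -/
def C (ε : B →+* A) : Subgroup (OneFiber ε) := Subgroup.closure (commSet ε)

instance normal_C (ε : B →+* A) : (C ε).Normal := by
  have key : ∀ g : OneFiber ε, ∀ c ∈ commSet ε, g * c * g⁻¹ ∈ commSet ε := by
    rintro g _ ⟨a, b, hab, hba, p, q, hp, hq, rfl⟩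
    refine ⟨g.1 * a * (g.1⁻¹).1, g.1 * b * (g.1⁻¹).1, ?_, ?_, g * p * g⁻¹, g * q * g⁻¹, ?_, ?_, ?_⟩
    · have : (g.1 * a * (g.1⁻¹).1 * (g.1 * b * (g.1⁻¹).1) : B) = g.1 * (a * b) * (g.1⁻¹).1 := by
        simp [mul_assoc]
      rw [this, map_mul, map_mul, hab, mul_zero, zero_mul]
    · have : (g.1 * b * (g.1⁻¹).1 * (g.1 * a * (g.1⁻¹).1) : B) = g.1 * (b * a) * (g.1⁻¹).1 := by
        simp [mul_assoc]
      rw [this, map_mul, map_mul, hba, mul_zero, zero_mul]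
    · change (g.1 * p.1 * (g.1⁻¹).1 : B) = _
      rw [hp]
      simp [mul_assoc, mul_add, add_mul]
    · change (g.1 * q.1 * (g.1⁻¹).1 : B) = _
      rw [hq]
      simp [mul_assoc, mul_add, add_mul]
    · group
  refine ⟨fun c hc g => ?_⟩
  induction hc using Subgroup.closure_induction with
  | mem x hx => exact Subgroup.subset_closure (key g x hx)
  | one => simp
  | mul x y _ _ hx hy => simpa [mul_assoc] using mul_mem hx hy
  | inv x _ hx => simpa [mul_assoc] using inv_mem hx

/-- The Schur complement `α₂₂ - α₂₁ α₁₁⁻¹ α₁₂` of the top left entry. -/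
noncomputable def schur (ε : B →+* A) [IsLocalHom ε] {n : ℕ}
    (α : Matrix (Fin (n + 1)) (Fin (n + 1)) B) (h : ε (α 0 0) = 1) : Matrix (Fin n) (Fin n) B :=
  Matrix.of fun i j => α i.succ j.succ -
    α i.succ 0 * (((ofOne ε (α 0 0) h)⁻¹ : OneFiber ε) : Bˣ) * α 0 j.succ

theorem map_head {ε : B →+* A} {n : ℕ} {α : Matrix (Fin (n + 1)) (Fin (n + 1)) B}
    (h : ε.mapMatrix α = 1) : ε (α 0 0) = 1 :=
  congrFun (congrFun h 0) 0

theorem map_schur {ε : B →+* A} [IsLocalHom ε] {n : ℕ}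
    {α : Matrix (Fin (n + 1)) (Fin (n + 1)) B} (h : ε.mapMatrix α = 1) :
    ε.mapMatrix (schur ε α (map_head h)) = 1 := by
  ext i j
  have h1 : ε (α i.succ j.succ) = (1 : Matrix _ _ A) i.succ j.succ :=
    congrFun (congrFun h i.succ) j.succ
  have h2 : ε (α i.succ 0) = 0 := congrFun (congrFun h i.succ) 0
  simp [schur, h1, h2, Matrix.one_apply]

/-- The determinant `D(α) ∈ ε⁻¹(1) / C` of a square matrix `α` over `B` with `ε(α) = 1`:
`D(α) = α₁₁ D(α₂₂ - α₂₁ α₁₁⁻¹ α₁₂)`, and `D(α) = α` for a `1 × 1` matrix. -/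
noncomputable def D (ε : B →+* A) [IsLocalHom ε] :
    (n : ℕ) → (α : Matrix (Fin n) (Fin n) B) → ε.mapMatrix α = 1 → OneFiber ε ⧸ C ε
  | 0, _, _ => 1
  | n + 1, α, h => QuotientGroup.mk (ofOne ε (α 0 0) (map_head h)) *
      D ε n (schur ε α (map_head h)) (map_schur h)

end LocalAugmentation

/-! ### The reduced endomorphism class group -/

namespace EndClass

variable (A : Type*) [Ring A]

/-- Pairs `(Aⁿ, α)` with `α` an endomorphism of the free left `A`-module `Aⁿ`. -/
abbrev Obj : Type _ := Σ n : ℕ, Module.End A (Fin n → A)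

/-- Isomorphism of pairs. -/
instance isoSetoid : Setoid (Obj A) where
  r X Y := ∃ e : (Fin X.1 → A) ≃ₗ[A] (Fin Y.1 → A), ∀ v, e (X.2 v) = Y.2 (e v)
  iseqv :=
    { refl := fun _ => ⟨LinearEquiv.refl _ _, fun _ => rfl⟩
      symm := fun ⟨e, he⟩ => ⟨e.symm, fun v => by
        rw [LinearEquiv.symm_apply_eq, he, LinearEquiv.apply_symm_apply]⟩
      trans := fun ⟨e, he⟩ ⟨e', he'⟩ => ⟨e.trans e', fun v => by
        simp [he, he']⟩ }

/-- Isomorphism classes of pairs. -/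
abbrev IsoClass : Type _ := Quotient (isoSetoid A)

variable {A} in
/-- There is an exact sequence `0 → X → X' → X'' → 0` of pairs. -/
def ShortExact (X X' X'' : Obj A) : Prop :=
  ∃ (f : (Fin X.1 → A) →ₗ[A] (Fin X'.1 → A)) (g : (Fin X'.1 → A) →ₗ[A] (Fin X''.1 → A)),
    (∀ v, f (X.2 v) = X'.2 (f v)) ∧ (∀ v, g (X'.2 v) = X''.2 (g v)) ∧
      Function.Injective f ∧ Function.Exact f g ∧ Function.Surjective g

variable {A} in
/-- The generator of the free abelian group given by the isomorphism class of `X`. -/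
def gen (X : Obj A) : FreeAbelianGroup (IsoClass A) :=
  FreeAbelianGroup.of (Quotient.mk (isoSetoid A) X)

/-- The relations `[X] + [X''] = [X']` for exact sequences `0 → X → X' → X'' → 0`, and
`[A, 0] = 0`. -/
def relations : Set (FreeAbelianGroup (IsoClass A)) :=
  {z | ∃ X X' X'' : Obj A, ShortExact X X' X'' ∧ z = gen X + gen X'' - gen X'} ∪
    {gen (⟨1, 0⟩ : Obj A)}

/-- The reduced endomorphism class group of `A`. -/
abbrev Group : Type _ := FreeAbelianGroup (IsoClass A) ⧸ AddSubgroup.closure (relations A)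

variable {A} in
/-- The class `[Aⁿ, α]`. -/
def cls (n : ℕ) (α : Module.End A (Fin n → A)) : Group A :=
  QuotientAddGroup.mk (gen (⟨n, α⟩ : Obj A))

end EndClass

/-! ### The polynomial ring -/

namespace PolynomialLocalization

open UniversalLocalization

variable (A : Type*) [Ring A]

/-- `Σ⁻¹A[x]`, where `Σ` is the set of matrices over `A[x]` invertible under `x ↦ 0`. -/
abbrev PolyLoc : Type _ := Loc (Polynomial.constantCoeff : Polynomial A →+* A)

/-- `ε_Σ : Σ⁻¹A[x] → A`. -/
noncomputable abbrev epsilon : PolyLoc A →+* A :=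
  aug (Polynomial.constantCoeff : Polynomial A →+* A)

variable {A}

/-- The image over `Σ⁻¹A[x]` of the matrix `1 - αx`. The endomorphism `α` of the left module `Aⁿ` is
identified with the matrix whose `i`-th row is `α(eᵢ)`, so that `α` is `v ↦ vα` on row vectors. -/
noncomputable def oneSubMulX {n : ℕ} (α : Module.End A (Fin n → A)) :
    Matrix (Fin n) (Fin n) (PolyLoc A) :=
  (incl _).mapMatrix
    (1 - (LinearMap.toMatrixRight' α).map fun a => Polynomial.C a * Polynomial.X)

theorem map_oneSubMulX {n : ℕ} (α : Module.End A (Fin n → A)) :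
    (epsilon A).mapMatrix (oneSubMulX α) = 1 := by
  ext i j
  simp only [oneSubMulX, RingHom.mapMatrix_apply, Matrix.map_apply, aug_incl, Matrix.sub_apply,
    map_sub, map_mul, Polynomial.constantCoeff_apply, Polynomial.coeff_X_zero, mul_zero, sub_zero,
    Matrix.one_apply]
  split_ifs <;> simp

end PolynomialLocalization

/-! Every element of `B` can be written `f (1 - αx)⁻¹ g` with a row `f`, a square matrix `α` and a
column `g` over `A`; its augmentation is `f g`. Two homomorphisms are constructed and compared.

From endomorphisms to `B`: the determinant is multiplicative (`det_mul`) and satisfies `det (1 + XY)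
= det (1 + YX)` when `ε` kills `Y` (`det_one_add_mul_comm`). An exact sequence of pairs splits as a
sequence of modules, so the middle matrix `α'` is a sum of two matrices with product zero. Hence `1
- α'x` factors, and the swap identity turns the factors into `1 - αx` and `1 - α''x`
(`charDet_exact`). This yields `charHom`.

From `B` to endomorphisms: `f (1 - αx)⁻¹ g` with `f g = 1` is sent to `[(1 - gf)α] - [α]`. The
formula is forced by `charDet_sub`, another instance of the swap identity: the determinant attached
to `(1 - gf)α` is `f (1 - αx)⁻¹ g` times the one attached to `α`. The expression of an element of
`B` is not unique, and the universal property alone does not say when two expressions agree. So `B`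
is replaced by an explicit model, `Rational A`: triples `(f, α, g)` modulo the moves `(f, α, φg) ~
(fφ, α', g)` for `αφ = φα'`. It is a ring with a local augmentation to `A`; the universal property
in one direction and evaluation of triples in the other identify it with `B` (`eval_ofLoc`,
`ofLoc_eval`). Well-definedness then needs checking for one move only (`tripleClass_congr`), and
additivity and triviality on `C` are identities of block matrices (`rationalClass_mul`,
`rationalClass_one_add_mul_comm`). This yields `fiberHom`.

By `charDet_sub`, `charHom` after `fiberHom` is the identity. Moreover `fiberHom` is onto: taking
basis vectors for `f` and `g` clears the rows of `α` one at a time, which expresses `[α]` through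
values of `rationalClass` (`matCls_mem_of_rationalClass_mem`). Hence both maps are bijective. -/

theorem Matrix.map_ringHom_add {R S : Type*} [Ring R] [Ring S] {m n : Type*} (f : R →+* S)
    (M N : Matrix m n R) : (M + N).map f = M.map f + N.map f := by
  ext; simp

theorem Matrix.map_ringHom_sub {R S : Type*} [Ring R] [Ring S] {m n : Type*} (f : R →+* S)
    (M N : Matrix m n R) : (M - N).map f = M.map f - N.map f := by
  ext; simp

theorem Matrix.map_ringHom_neg {R S : Type*} [Ring R] [Ring S] {m n : Type*} (f : R →+* S)
    (M : Matrix m n R) : (-M).map f = -M.map f := by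
  ext; simp

theorem Matrix.map_ringHom_one {R S : Type*} [Ring R] [Ring S] {m : Type*} [DecidableEq m]
    (f : R →+* S) : (1 : Matrix m m R).map f = 1 :=
  Matrix.map_one _ (map_zero _) (map_one _)

theorem Matrix.map_ringHom_zero {R S : Type*} [Ring R] [Ring S] {m n : Type*}
    (f : R →+* S) : (0 : Matrix m n R).map f = 0 :=
  Matrix.map_zero _ (map_zero _)

/-- The inverse of `1 + u l` in terms of an inverse of `1 + l u`. -/
theorem Matrix.one_add_mul_sylvester {R : Type*} [Ring R] {m n : Type*} [Fintype m] [Fintype n]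
    [DecidableEq m] [DecidableEq n] {X : Matrix m n R} {Y : Matrix n m R} {q : Matrix m m R}
    (h : (1 + X * Y) * q = 1) : (1 + Y * X) * (1 - Y * q * X) = 1 := by
  have e : X * (Y * q) = 1 - q := by
    rw [← h, Matrix.add_mul, Matrix.one_mul, Matrix.mul_assoc, add_sub_cancel_left]
  have e' : Y * X * (Y * q * X) = Y * X - Y * q * X := by
    rw [Matrix.mul_assoc Y X, ← Matrix.mul_assoc X, e, Matrix.sub_mul, Matrix.mul_sub,
      Matrix.one_mul, Matrix.mul_assoc Y q]
  rw [Matrix.mul_sub, Matrix.mul_one, Matrix.add_mul, e', Matrix.one_mul]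
  abel

theorem Matrix.one_add_mul_sylvester' {R : Type*} [Ring R] {m n : Type*} [Fintype m] [Fintype n]
    [DecidableEq m] [DecidableEq n] {X : Matrix m n R} {Y : Matrix n m R} {q : Matrix m m R}
    (h : q * (1 + X * Y) = 1) : (1 - Y * q * X) * (1 + Y * X) = 1 := by
  have e : q * (X * Y) = 1 - q := by
    rw [← h, Matrix.mul_add, Matrix.mul_one, add_sub_cancel_left]
  have e' : Y * q * X * (Y * X) = Y * X - Y * q * X := by
    rw [Matrix.mul_assoc, ← Matrix.mul_assoc X, Matrix.mul_assoc, ← Matrix.mul_assoc q, e,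
      Matrix.sub_mul, Matrix.mul_sub, Matrix.one_mul, Matrix.mul_assoc Y q]
  rw [Matrix.mul_add, Matrix.mul_one, Matrix.sub_mul, e', Matrix.one_mul]
  abel

/-! ### Calculus of the determinant `D`: multiplicativity and the swap identity. -/

namespace LocalAugmentation

variable {B A : Type*} [Ring B] [Ring A]

theorem map_unit_apply {ε : B →+* A} {p : Matrix Unit Unit B} (hp : p.map ε = 1) :
    ε (p () ()) = 1 :=
  congrFun (congrFun hp ()) ()

section

variable (ε : B →+* A) [IsLocalHom ε]

/-- The class in `ε⁻¹(1) / C` of an element `b` with `ε b = 1` (and `1` for all other `b`). -/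
noncomputable def elemClass (b : B) : OneFiber ε ⧸ C ε :=
  open Classical in if h : ε b = 1 then QuotientGroup.mk (ofOne ε b h) else 1

variable {ε}

theorem elemClass_eq {b : B} (h : ε b = 1) : elemClass ε b = QuotientGroup.mk (ofOne ε b h) :=
  dif_pos h

theorem elemClass_mul {b c : B} (hb : ε b = 1) (hc : ε c = 1) :
    elemClass ε (b * c) = elemClass ε b * elemClass ε c := by
  have h : ε (b * c) = 1 := by rw [map_mul, hb, hc, one_mul]
  rw [elemClass_eq hb, elemClass_eq hc, elemClass_eq h, ← QuotientGroup.mk_mul]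
  congr 1
  ext
  rfl

theorem elemClass_one : elemClass ε 1 = 1 := by
  have h := elemClass_mul (ε := ε) (map_one ε) (map_one ε)
  rw [mul_one] at h
  exact left_eq_mul.mp h

/-- The generators of `C` enter the determinant calculus only here; commutativity of the quotient
and the swap identities for matrices all reduce to it. -/
theorem elemClass_swap {a b : B} (hab : ε (a * b) = 0) (hba : ε (b * a) = 0) :
    elemClass ε (1 + a * b) = elemClass ε (1 + b * a) := by
  have h1 : ε (1 + a * b) = 1 := by rw [map_add, hab, map_one, add_zero]
  have h2 : ε (1 + b * a) = 1 := by rw [map_add, hba, map_one, add_zero]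
  rw [elemClass_eq h1, elemClass_eq h2, ← mul_inv_eq_one, ← QuotientGroup.mk_inv,
    ← QuotientGroup.mk_mul, QuotientGroup.eq_one_iff]
  exact Subgroup.subset_closure ⟨a, b, hab, hba, _, _, coe_ofOne .., coe_ofOne .., rfl⟩

theorem exists_elemClass (g : OneFiber ε ⧸ C ε) : ∃ b, ε b = 1 ∧ elemClass ε b = g := by
  obtain ⟨p, rfl⟩ := QuotientGroup.mk_surjective g
  have hp : ε (p : Bˣ) = 1 := congrArg Units.val p.2
  refine ⟨(p : Bˣ), hp, ?_⟩
  rw [elemClass_eq hp]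
  congr 1
  ext
  rfl

theorem elemClass_comm {p q : B} (hp : ε p = 1) (hq : ε q = 1) :
    elemClass ε (p * q) = elemClass ε (q * p) := by
  obtain ⟨u, rfl⟩ := IsUnit.of_map ε p (hp ▸ isUnit_one)
  have hu : ε ((u⁻¹ : Bˣ) : B) = 1 := by
    have := congrArg ε u.inv_mul
    rwa [map_mul, hp, mul_one, map_one] at this
  -- With this `b`, `1 + ab = uq` and `1 + ba = qu`.
  have h := elemClass_swap (ε := ε) (a := u) (b := q - (u⁻¹ : Bˣ)) (by simp [hp, hq, hu])
    (by simp [hp, hq, hu])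
  simpa [mul_sub, sub_mul] using h

/-- `ε⁻¹(1) / C` is commutative. -/
noncomputable instance : CommGroup (OneFiber ε ⧸ C ε) where
  mul_comm g h := by
    obtain ⟨b, hb, rfl⟩ := exists_elemClass g
    obtain ⟨c, hc, rfl⟩ := exists_elemClass h
    rw [← elemClass_mul hb hc, ← elemClass_mul hc hb, elemClass_comm hb hc]

variable (ε) in
/-- The determinant as a total function. -/
noncomputable def det {n : ℕ} (α : Matrix (Fin n) (Fin n) B) : OneFiber ε ⧸ C ε :=
  open Classical in if h : α.map ε = 1 then D ε n α h else 1

theorem det_eq {n : ℕ} {α : Matrix (Fin n) (Fin n) B} (h : ε.mapMatrix α = 1) :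
    det ε α = D ε n α h :=
  dif_pos h

variable (ε) in
/-- The class of a `1 × 1` matrix. -/
noncomputable def unitClass (p : Matrix Unit Unit B) : OneFiber ε ⧸ C ε := elemClass ε (p () ())

theorem unitClass_mul {p q : Matrix Unit Unit B} (hp : p.map ε = 1) (hq : q.map ε = 1) :
    unitClass ε (p * q) = unitClass ε p * unitClass ε q := by
  rw [unitClass, unitClass, unitClass, ← elemClass_mul (map_unit_apply hp) (map_unit_apply hq)]
  simp [Matrix.mul_apply]

theorem unitClass_one : unitClass ε 1 = 1 := elemClass_one

theorem unitClass_swap {a b : Matrix Unit Unit B} (hab : (a * b).map ε = 0)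
    (hba : (b * a).map ε = 0) : unitClass ε (1 + a * b) = unitClass ε (1 + b * a) := by
  have h1 := congrFun (congrFun hab ()) ()
  have h2 := congrFun (congrFun hba ()) ()
  simp only [Matrix.map_apply, Matrix.mul_apply, Finset.univ_unique, Finset.sum_singleton,
    Matrix.zero_apply] at h1 h2
  simpa [unitClass, Matrix.mul_apply] using elemClass_swap h1 h2

theorem exists_inv_unit {p : Matrix Unit Unit B} (hp : p.map ε = 1) :
    ∃ q : Matrix Unit Unit B, q * p = 1 ∧ p * q = 1 ∧ q.map ε = 1 := by
  obtain ⟨u, hu⟩ := IsUnit.of_map ε (p ()  ()) (map_unit_apply hp ▸ isUnit_one)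
  have h1 : (Matrix.of fun _ _ => ((u⁻¹ : Bˣ) : B)) * p = 1 := by
    ext
    simp [Matrix.mul_apply, ← hu]
  have h2 : p * (Matrix.of fun _ _ => ((u⁻¹ : Bˣ) : B)) = 1 := by
    ext
    simp [Matrix.mul_apply, ← hu]
  refine ⟨_, h1, h2, ?_⟩
  have := congrArg (fun M => M.map ε) h1
  simpa [Matrix.map_mul, hp, Matrix.map_ringHom_one] using this

end

/-- The index set of a matrix with its first row and column singled out. -/
def blockIndex (n : ℕ) : Unit ⊕ Fin n ≃ Fin (n + 1) where
  toFun := Sum.elim (fun _ => 0) Fin.succ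
  invFun := Fin.cases (Sum.inl ()) Sum.inr
  left_inv := by rintro (_ | _) <;> rfl
  right_inv i := by cases i using Fin.cases <;> rfl

/-- The `(n + 1) × (n + 1)` matrix with given top left entry, top row, left column and rest. -/
def block {n : ℕ} (p : Matrix Unit Unit B) (r : Matrix Unit (Fin n) B) (c : Matrix (Fin n) Unit B)
    (M : Matrix (Fin n) (Fin n) B) : Matrix (Fin (n + 1)) (Fin (n + 1)) B :=
  Matrix.reindexRingEquiv B (blockIndex n) (Matrix.fromBlocks p r c M)

theorem exists_block {n : ℕ} (α : Matrix (Fin (n + 1)) (Fin (n + 1)) B) :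
    ∃ p r c M, α = block p r c M := by
  refine ⟨_, _, _, _, ((Matrix.reindexRingEquiv B (blockIndex n)).apply_symm_apply α).symm.trans
    (congrArg _ (Matrix.fromBlocks_toBlocks _).symm)⟩

theorem block_mul {n : ℕ} (p p' : Matrix Unit Unit B) (r r' : Matrix Unit (Fin n) B)
    (c c' : Matrix (Fin n) Unit B) (M M' : Matrix (Fin n) (Fin n) B) :
    block p r c M * block p' r' c' M' =
      block (p * p' + r * c') (p * r' + r * M') (c * p' + M * c') (c * r' + M * M') := by
  rw [block, block, block, ← map_mul, Matrix.fromBlocks_multiply]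

theorem block_one {n : ℕ} :
    block (1 : Matrix Unit Unit B) 0 0 (1 : Matrix (Fin n) (Fin n) B) = 1 := by
  rw [block, Matrix.fromBlocks_one, map_one]

theorem block_add {n : ℕ} (p p' : Matrix Unit Unit B) (r r' : Matrix Unit (Fin n) B)
    (c c' : Matrix (Fin n) Unit B) (M M' : Matrix (Fin n) (Fin n) B) :
    block p r c M + block p' r' c' M' = block (p + p') (r + r') (c + c') (M + M') := by
  rw [block, block, block, ← map_add, Matrix.fromBlocks_add]

theorem map_block {n : ℕ} (ε : B →+* A) (p : Matrix Unit Unit B) (r : Matrix Unit (Fin n) B)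
    (c : Matrix (Fin n) Unit B) (M : Matrix (Fin n) (Fin n) B) :
    (block p r c M).map ε = block (p.map ε) (r.map ε) (c.map ε) (M.map ε) := by
  rw [block, block, ← Matrix.fromBlocks_map]
  rfl

theorem block_inj {n : ℕ} {p p' : Matrix Unit Unit B} {r r' : Matrix Unit (Fin n) B}
    {c c' : Matrix (Fin n) Unit B} {M M' : Matrix (Fin n) (Fin n) B} :
    block p r c M = block p' r' c' M' ↔ p = p' ∧ r = r' ∧ c = c' ∧ M = M' := by
  rw [block, block, (Matrix.reindexRingEquiv B (blockIndex n)).injective.eq_iff,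
    Matrix.fromBlocks_inj]

theorem map_block_eq_one {n : ℕ} {ε : B →+* A} {p : Matrix Unit Unit B}
    {r : Matrix Unit (Fin n) B} {c : Matrix (Fin n) Unit B} {M : Matrix (Fin n) (Fin n) B} :
    (block p r c M).map ε = 1 ↔ p.map ε = 1 ∧ r.map ε = 0 ∧ c.map ε = 0 ∧ M.map ε = 1 := by
  rw [map_block, ← block_one, block_inj]

section

variable {ε : B →+* A} [IsLocalHom ε]

theorem det_zero (α : Matrix (Fin 0) (Fin 0) B) : det ε α = 1 := by
  rw [det_eq (Subsingleton.elim _ _)]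
  rfl

/-- The recursion defining `D` in block form. The inverse of the corner is any given left inverse
`q`, so that explicit formulas for inverses can be substituted. -/
theorem det_block {n : ℕ} {p q : Matrix Unit Unit B} {r : Matrix Unit (Fin n) B}
    {c : Matrix (Fin n) Unit B} {M : Matrix (Fin n) (Fin n) B} (hp : p.map ε = 1)
    (hr : r.map ε = 0) (hc : c.map ε = 0) (hM : M.map ε = 1) (hq : q * p = 1) :
    det ε (block p r c M) = unitClass ε p * det ε (M - c * q * r) := by
  have h : ε.mapMatrix (block p r c M) = 1 := map_block_eq_one.mpr ⟨hp, hr, hc, hM⟩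
  have hp' : ε ((block p r c M) 0 0) = 1 := map_head h
  have hqp : q () () * p () () = 1 := by
    simpa [Matrix.mul_apply] using congrFun (congrFun hq ()) ()
  have hs : schur ε (block p r c M) hp' = M - c * q * r := by
    have hinv : (((ofOne ε _ hp')⁻¹ : OneFiber ε) : Bˣ) = (q () () : B) := by
      refine (left_inv_eq_right_inv hqp ?_).symm
      exact ((ofOne ε _ hp' : OneFiber ε) : Bˣ).mul_inv
    ext i j
    rw [schur, Matrix.of_apply, hinv]
    simp only [Matrix.sub_apply, Matrix.mul_apply, Finset.univ_unique, Finset.sum_singleton]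
    rfl
  rw [det_eq h, D, ← elemClass_eq hp']
  congr 1
  rw [← hs, det_eq (map_schur h)]

theorem det_one (n : ℕ) : det ε (1 : Matrix (Fin n) (Fin n) B) = 1 := by
  induction n with
  | zero => exact det_zero _
  | succ n ih =>
    rw [← block_one, det_block (q := 1) (Matrix.map_ringHom_one ε) (Matrix.map_ringHom_zero ε)
      (Matrix.map_ringHom_zero ε) (Matrix.map_ringHom_one ε) (one_mul 1)]
    simpa [unitClass_one] using ih

/-- Split off the first entries `l₀`, `u₀`. The corner is `1 + l₀u₀`, whose class is that of `1 +
u₀l₀` by a generator of `C`. The Schur complement is again a rank-one perturbation of `1`, with `u₁`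
replaced by `(1 + u₀l₀)⁻¹u₁`, so induction applies and the two classes multiply to that of `1 + u₀l₀
+ u₁l₁`. -/
theorem det_one_add_col_mul_row {n : ℕ} (l : Matrix (Fin n) Unit B) (u : Matrix Unit (Fin n) B)
    (hu : u.map ε = 0) : det ε (1 + l * u) = unitClass ε (1 + u * l) := by
  induction n with
  | zero =>
    rw [det_zero]
    have : u * l = 0 := by ext; simp [Matrix.mul_apply]
    rw [this, add_zero, unitClass_one]
  | succ n ih =>
    obtain ⟨l, rfl⟩ := (Matrix.reindex (blockIndex n) (Equiv.refl _)).surjective l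
    obtain ⟨u, rfl⟩ := (Matrix.reindex (Equiv.refl _) (blockIndex n)).surjective u
    rw [← Matrix.fromRows_toRows l]
    rw [← Matrix.fromCols_toCols u] at hu ⊢
    generalize l.toRows₁ = l₀, l.toRows₂ = l₁ at *
    generalize u.toCols₁ = u₀, u.toCols₂ = u₁ at *
    have hu0 : u₀.map ε = 0 := by
      ext i j
      exact congrFun (congrFun hu i) (blockIndex n (Sum.inl j))
    have hu1 : u₁.map ε = 0 := by
      ext i j
      exact congrFun (congrFun hu i) (blockIndex n (Sum.inr j))
    have e1 : 1 + Matrix.reindex (blockIndex n) (Equiv.refl _) (Matrix.fromRows l₀ l₁) *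
        Matrix.reindex (Equiv.refl _) (blockIndex n) (Matrix.fromCols u₀ u₁) =
        block (1 + l₀ * u₀) (l₀ * u₁) (l₁ * u₀) (1 + l₁ * u₁) := by
      have : Matrix.reindex (blockIndex n) (Equiv.refl _) (Matrix.fromRows l₀ l₁) *
        Matrix.reindex (Equiv.refl _) (blockIndex n) (Matrix.fromCols u₀ u₁) =
          block (l₀ * u₀) (l₀ * u₁) (l₁ * u₀) (l₁ * u₁) := by
        rw [block, ← Matrix.fromRows_mul_fromCols]
        rfl
      rw [this, ← block_one, block_add]
      simp
    have e2 : Matrix.reindex (Equiv.refl _) (blockIndex n) (Matrix.fromCols u₀ u₁) *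
        Matrix.reindex (blockIndex n) (Equiv.refl _) (Matrix.fromRows l₀ l₁) =
          u₀ * l₀ + u₁ * l₁ := by
      rw [← Matrix.fromCols_mul_fromRows]
      exact Matrix.submatrix_mul_equiv (Matrix.fromCols u₀ u₁) (Matrix.fromRows l₀ l₁) id
        (blockIndex n).symm id
    have h1 : (1 + l₀ * u₀).map ε = 1 := by
      simp [Matrix.map_ringHom_add, Matrix.map_mul, hu0]
    have h2 : (1 + u₀ * l₀).map ε = 1 := by
      simp [Matrix.map_ringHom_add, Matrix.map_mul, hu0]
    obtain ⟨q, hq, hq', hqε⟩ := exists_inv_unit h1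
    have e3 : 1 + l₁ * u₁ - l₁ * u₀ * q * (l₀ * u₁) =
        1 + l₁ * ((1 - u₀ * q * l₀) * u₁) := by
      simp only [Matrix.sub_mul, Matrix.mul_sub, Matrix.one_mul, Matrix.mul_assoc]
      abel
    rw [e1, e2, det_block (q := q) h1 (by simp [Matrix.map_mul, hu1])
      (by simp [Matrix.map_mul, hu0])
      (by simp [Matrix.map_ringHom_add, Matrix.map_mul, hu1]) hq, e3,
      ih _ _ (by simp [Matrix.map_mul, hu1]),
      unitClass_swap (by simp [Matrix.map_mul, hu0]) (by simp [Matrix.map_mul, hu0]),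
      ← unitClass_mul h2 (by simp [Matrix.map_ringHom_add, Matrix.map_mul, hu1])]
    congr 1
    -- `1 - u₀ q l₀` is the inverse of `1 + u₀l₀`.
    rw [Matrix.mul_add, Matrix.mul_assoc _ u₁, ← Matrix.mul_assoc (1 + u₀ * l₀),
      Matrix.one_add_mul_sylvester hq', Matrix.one_mul, Matrix.mul_one, add_assoc]

/-- With `u = p⁻¹r`, `l = c'p'⁻¹` and `t = (1 + ul)⁻¹`, the product has corner `p(1 + ul)p'` and
Schur complement `S(1 - ltu)S'`, where `S`, `S'` are the Schur complements of the factors. The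
rank-one case shows that the middle factor contributes the class of `t`, which cancels the surplus
`1 + ul` in the corner. -/
theorem det_mul {n : ℕ} {α β : Matrix (Fin n) (Fin n) B} (hα : α.map ε = 1) (hβ : β.map ε = 1) :
    det ε (α * β) = det ε α * det ε β := by
  induction n with
  | zero => simp only [det_zero, mul_one]
  | succ n ih =>
    obtain ⟨p, r, c, M, rfl⟩ := exists_block α
    obtain ⟨p', r', c', M', rfl⟩ := exists_block β
    obtain ⟨hp, hr, hc, hM⟩ := map_block_eq_one.mp hα
    obtain ⟨hp', hr', hc', hM'⟩ := map_block_eq_one.mp hβ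
    obtain ⟨q, hq, hq', hqε⟩ := exists_inv_unit hp
    obtain ⟨q', hqp', hpq', _⟩ := exists_inv_unit hp'
    set S := M - c * q * r with hS
    set S' := M' - c' * q' * r' with hS'
    set u := q * r with hu
    set l := c' * q' with hl
    have hSε : S.map ε = 1 := by
      simp [hS, Matrix.map_ringHom_sub, Matrix.map_mul, hM, hc]
    have hlε : l.map ε = 0 := by simp [hl, Matrix.map_mul, hc']
    have hSε' : S'.map ε = 1 := by
      simp [hS', Matrix.map_ringHom_sub, Matrix.map_mul, hM', hlε]
    have huε : u.map ε = 0 := by simp [hu, Matrix.map_mul, hr]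
    have h1 : (1 + u * l).map ε = 1 := by
      simp [Matrix.map_ringHom_add, Matrix.map_mul, huε]
    obtain ⟨t, ht, ht', htε⟩ := exists_inv_unit h1
    have er : r = p * u := by rw [hu, ← Matrix.mul_assoc, hq', Matrix.one_mul]
    have ec : c' = l * p' := by rw [hl, Matrix.mul_assoc, hqp', Matrix.mul_one]
    have eM : M = S + c * u := by rw [hS, hu, Matrix.mul_assoc]; abel
    have eM' : M' = S' + l * r' := by rw [hS', hl]; abel
    have e1 : p * p' + r * c' = p * (1 + u * l) * p' := by
      rw [er, ec]; simp only [Matrix.mul_add, Matrix.add_mul, Matrix.mul_assoc, Matrix.one_mul]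
    have e2 : q' * t * q * (p * p' + r * c') = 1 := by
      rw [e1]
      have : q' * t * q * (p * (1 + u * l) * p') = q' * (t * ((q * p) * (1 + u * l))) * p' := by
        simp only [Matrix.mul_assoc]
      rw [this, hq, Matrix.one_mul, ht, Matrix.mul_one, hqp']
    have hW : (1 - l * t * u).map ε = 1 := by
      simp [Matrix.map_ringHom_sub, Matrix.map_mul, huε]
    have e3 : c * r' + M * M' - (c * p' + M * c') * (q' * t * q) * (p * r' + r * M') =
        S * ((1 - l * t * u) * S') := by
      have a1 : c * p' + M * c' = (c * (1 + u * l) + S * l) * p' := by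
        rw [eM, ec]
        simp only [Matrix.mul_add, Matrix.add_mul, Matrix.mul_assoc, Matrix.mul_one]
        abel
      have a2 : p * r' + r * M' = p * ((1 + u * l) * r' + u * S') := by
        rw [eM', er]
        simp only [Matrix.mul_add, Matrix.add_mul, Matrix.mul_assoc, Matrix.one_mul]
        abel
      have a3 : (c * p' + M * c') * (q' * t * q) * (p * r' + r * M') =
          (c * (1 + u * l) + S * l) * (t * ((1 + u * l) * r' + u * S')) := by
        rw [a1, a2]
        have : (c * (1 + u * l) + S * l) * p' * (q' * t * q) *
            (p * ((1 + u * l) * r' + u * S')) =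
            (c * (1 + u * l) + S * l) * ((p' * q') * (t * ((q * p) *
              ((1 + u * l) * r' + u * S')))) := by
          simp only [Matrix.mul_assoc]
        rw [this, hpq', hq, Matrix.one_mul, Matrix.one_mul]
      have a4 : (c * (1 + u * l) + S * l) * (t * ((1 + u * l) * r' + u * S')) =
          c * ((1 + u * l) * r' + u * S') + S * l * r' + S * (l * t * u) * S' := by
        rw [Matrix.add_mul, Matrix.mul_assoc c, ← Matrix.mul_assoc _ t, ht', Matrix.one_mul,
          Matrix.mul_add t, ← Matrix.mul_assoc t, ht, Matrix.one_mul, Matrix.mul_add (S * l)]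
        simp only [Matrix.mul_assoc]
        abel
      rw [a3, a4, eM, eM']
      simp only [Matrix.mul_add, Matrix.add_mul, Matrix.mul_assoc, Matrix.mul_sub, Matrix.sub_mul,
        Matrix.one_mul]
      abel
    have hn1 : (p * p' + r * c').map ε = 1 := by
      simp [Matrix.map_ringHom_add, Matrix.map_mul, hp, hp', hr]
    -- Swapping gives `1 - ult`, and this equals `t` because `(1 + ul)t = 1`.
    have hdet : det ε (1 - l * t * u) = unitClass ε t := by
      have := det_one_add_col_mul_row (ε := ε) (-(l * t)) u huε
      rw [Matrix.neg_mul, ← sub_eq_add_neg] at this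
      rw [this, Matrix.mul_neg, ← sub_eq_add_neg]
      congr 1
      have h2 : (1 + u * l) * t = t + u * (l * t) := by
        rw [Matrix.add_mul, Matrix.one_mul, Matrix.mul_assoc]
      rw [← ht', h2, add_sub_cancel_right]
    rw [block_mul, det_block (q := q' * t * q) hn1
      (by simp [Matrix.map_ringHom_add, Matrix.map_mul, hr', hr])
      (by simp [Matrix.map_ringHom_add, Matrix.map_mul, hc', hc])
      (by simp [Matrix.map_ringHom_add, Matrix.map_mul, hM, hM', hc]) e2, e3,
      ih hSε (by simp [Matrix.map_mul, hW, hSε']), ih hW hSε', hdet,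
      det_block hp hr hc hM hq, det_block hp' hr' hc' hM' hqp', e1, ← hS, ← hS',
      unitClass_mul (by simp [Matrix.map_mul, hp, h1]) hp', unitClass_mul hp h1]
    have h3 : unitClass ε (1 + u * l) * unitClass ε t = 1 := by
      rw [← unitClass_mul h1 htε, ht', unitClass_one]
    calc _ = (unitClass ε (1 + u * l) * unitClass ε t) *
        (unitClass ε p * det ε S * (unitClass ε p' * det ε S')) := by ac_rfl
      _ = _ := by rw [h3, one_mul]

/-- Block elimination: the matrix is a lower triangular block matrix with corner `p` times an upper
triangular one with the Schur complement in the last place, to which induction applies. -/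
theorem isUnit_of_map_eq_one {n : ℕ} {α : Matrix (Fin n) (Fin n) B} (hα : α.map ε = 1) :
    IsUnit α := by
  induction n with
  | zero => exact isUnit_of_subsingleton _
  | succ n ih =>
    obtain ⟨p, r, c, M, rfl⟩ := exists_block α
    obtain ⟨hp, hr, hc, hM⟩ := map_block_eq_one.mp hα
    obtain ⟨q, hq, hq', hqε⟩ := exists_inv_unit hp
    have hS : IsUnit (M - c * q * r) :=
      ih (by simp [Matrix.map_ringHom_sub, Matrix.map_mul, hM, hc])
    have e : block p r c M = block p 0 c 1 * block 1 (q * r) 0 (M - c * q * r) := by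
      rw [block_mul]
      simp [← Matrix.mul_assoc, hq']
    have hpu : IsUnit p := ⟨⟨p, q, hq', hq⟩, rfl⟩
    rw [e]
    exact ((UniversalLocalization.isUnit_fromBlocks' hpu isUnit_one c).map _).mul
      ((UniversalLocalization.isUnit_fromBlocks isUnit_one hS (q * r)).map _)

/-- Induction on the inner size: peel off a column `x` of `X` and the matching row `y` of `Y`. The
Schur complement of `1 + YX` is `1 + Y(1 + xy)⁻¹X`; induction moves `Y` to the right, and the corner
`1 + yx` has the same class as `1 + xy`. Multiplicativity recombines these to `1 + xy + XY`. -/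
theorem det_one_add_mul_comm {n m : ℕ} (X : Matrix (Fin n) (Fin m) B) (Y : Matrix (Fin m) (Fin n) B)
    (hY : Y.map ε = 0) : det ε (1 + X * Y) = det ε (1 + Y * X) := by
  induction m generalizing n with
  | zero =>
    rw [det_zero]
    have : X * Y = 0 := by ext; simp [Matrix.mul_apply]
    rw [this, add_zero, det_one]
  | succ m ih =>
    obtain ⟨X, rfl⟩ := (Matrix.reindex (Equiv.refl _) (blockIndex m)).surjective X
    obtain ⟨Y, rfl⟩ := (Matrix.reindex (blockIndex m) (Equiv.refl _)).surjective Y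
    rw [← Matrix.fromCols_toCols X]
    rw [← Matrix.fromRows_toRows Y] at hY ⊢
    generalize X.toCols₁ = x, X.toCols₂ = X at *
    generalize Y.toRows₁ = y, Y.toRows₂ = Y at *
    have hy : y.map ε = 0 := by
      ext i j
      exact congrFun (congrFun hY (blockIndex m (Sum.inl i))) j
    have hY : Y.map ε = 0 := by
      ext i j
      exact congrFun (congrFun hY (blockIndex m (Sum.inr i))) j
    have e1 : 1 + Matrix.reindex (blockIndex m) (Equiv.refl _) (Matrix.fromRows y Y) *
        Matrix.reindex (Equiv.refl _) (blockIndex m) (Matrix.fromCols x X) =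
        block (1 + y * x) (y * X) (Y * x) (1 + Y * X) := by
      have : Matrix.reindex (blockIndex m) (Equiv.refl _) (Matrix.fromRows y Y) *
        Matrix.reindex (Equiv.refl _) (blockIndex m) (Matrix.fromCols x X) =
          block (y * x) (y * X) (Y * x) (Y * X) := by
        rw [block, ← Matrix.fromRows_mul_fromCols]
        rfl
      rw [this, ← block_one, block_add]
      simp
    have e2 : Matrix.reindex (Equiv.refl _) (blockIndex m) (Matrix.fromCols x X) *
        Matrix.reindex (blockIndex m) (Equiv.refl _) (Matrix.fromRows y Y) =
          x * y + X * Y := by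
      rw [← Matrix.fromCols_mul_fromRows]
      exact Matrix.submatrix_mul_equiv (Matrix.fromCols x X) (Matrix.fromRows y Y) id
        (blockIndex m).symm id
    have h1 : (1 + y * x).map ε = 1 := by
      simp [Matrix.map_ringHom_add, Matrix.map_mul, hy]
    have h2 : (1 + x * y).map ε = 1 := by
      simp [Matrix.map_ringHom_add, Matrix.map_mul, hy]
    obtain ⟨q, hq, hq', hqε⟩ := exists_inv_unit h1
    have e3 : 1 + Y * X - Y * x * q * (y * X) = 1 + Y * ((1 - x * q * y) * X) := by
      simp only [Matrix.sub_mul, Matrix.mul_sub, Matrix.one_mul, Matrix.mul_assoc]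
      abel
    have h3 : (1 - x * q * y).map ε = 1 := by
      simp [Matrix.map_ringHom_sub, Matrix.map_mul, hy]
    rw [e1, e2, det_block (q := q) h1 (by simp [Matrix.map_mul, hy]) (by simp [Matrix.map_mul, hY])
      (by simp [Matrix.map_ringHom_add, Matrix.map_mul, hY]) hq, e3,
      ← ih _ _ hY, ← det_one_add_col_mul_row _ _ hy, ← det_mul h2
        (by simp [Matrix.map_ringHom_add, Matrix.map_mul, hY])]
    congr 1
    rw [Matrix.mul_add, Matrix.mul_assoc _ X, ← Matrix.mul_assoc (1 + x * y),
      Matrix.one_add_mul_sylvester hq', Matrix.one_mul, Matrix.mul_one, add_assoc]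

end

end LocalAugmentation

/-! ### The ring of triples `(f, α, g)`, a model of the universal localization. -/

namespace Matrix

variable {R : Type*} [AddZeroClass R] {m n m₁ m₂ n₁ n₂ : Type*}

theorem fromCols_add_fromCols (A₁ B₁ : Matrix m n₁ R) (A₂ B₂ : Matrix m n₂ R) :
    fromCols A₁ A₂ + fromCols B₁ B₂ = fromCols (A₁ + B₁) (A₂ + B₂) := by
  ext _ (_ | _) <;> rfl

theorem fromRows_add_fromRows (A₁ B₁ : Matrix m₁ n R) (A₂ B₂ : Matrix m₂ n R) :
    fromRows A₁ A₂ + fromRows B₁ B₂ = fromRows (A₁ + B₁) (A₂ + B₂) := by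
  ext (_ | _) _ <;> rfl

end Matrix

/-- A triple consisting of a row `f`, a square matrix `α` and a column `g` over `A`, a realization
of the formal expression `f (1 - αx)⁻¹ g`. -/
structure Realization (A : Type*) [Ring A] where
  /-- A triple. -/
  ofTriple ::
  /-- The index set of the square matrix. -/
  index : Type
  [fintype : Fintype index]
  [decidableEq : DecidableEq index]
  /-- The row `f`. -/
  row : Matrix Unit index A
  /-- The square matrix `α`. -/
  mat : Matrix index index A
  /-- The column `g`. -/
  col : Matrix index Unit A

namespace Realization

attribute [instance] fintype decidableEq

variable {A : Type*} [Ring A]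

/-- The relation `(f, α, φ g) ~ (f φ, α', g)` for `α φ = φ α'`. -/
def Rel (X Y : Realization A) : Prop :=
  ∃ φ : Matrix X.index Y.index A, X.mat * φ = φ * Y.mat ∧ X.row * φ = Y.row ∧ X.col = φ * Y.col

theorem Rel.ofTriple {κ l : Type} [Fintype κ] [DecidableEq κ] [Fintype l] [DecidableEq l]
    {f : Matrix Unit κ A} {α : Matrix κ κ A} {g : Matrix κ Unit A} {f' : Matrix Unit l A}
    {α' : Matrix l l A} {g' : Matrix l Unit A} (φ : Matrix κ l A) (h : α * φ = φ * α')
    (hf : f * φ = f') (hg : g = φ * g') :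
    Rel (Realization.ofTriple κ f α g) (Realization.ofTriple l f' α' g') :=
  ⟨φ, h, hf, hg⟩

variable (A) in
/-- The ring of formal expressions `f (1 - αx)⁻¹ g`. -/
def Rational : Type _ := Quot (Rel (A := A))

/-- The class of a realization. -/
def mk {κ : Type} [Fintype κ] [DecidableEq κ] (f : Matrix Unit κ A) (α : Matrix κ κ A)
    (g : Matrix κ Unit A) : Rational A := Quot.mk _ (ofTriple κ f α g)

/-- The move is dictated by `(1 - αx)φ = φ(1 - α'x)`, whence `f (1 - αx)⁻¹ φg' = fφ (1 - α'x)⁻¹ g'`.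
Each ring identity below comes from a suitable `φ`. -/
theorem mk_eq {κ l : Type} [Fintype κ] [DecidableEq κ] [Fintype l] [DecidableEq l]
    {f : Matrix Unit κ A} {α : Matrix κ κ A} {g : Matrix κ Unit A} {f' : Matrix Unit l A}
    {α' : Matrix l l A} {g' : Matrix l Unit A} (φ : Matrix κ l A) (h : α * φ = φ * α')
    (hf : f * φ = f') (hg : g = φ * g') : mk f α g = mk f' α' g' :=
  Quot.sound ⟨φ, h, hf, hg⟩

theorem Rational.ind {p : Rational A → Prop}
    (h : ∀ (κ : Type) [Fintype κ] [DecidableEq κ] (f : Matrix Unit κ A) (α : Matrix κ κ A)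
      (g : Matrix κ Unit A), p (mk f α g)) (b : Rational A) : p b := by
  obtain ⟨⟨κ, f, α, g⟩, rfl⟩ := Quot.exists_rep b
  exact h κ f α g

/-- The direct sum of realizations. -/
def add (X Y : Realization A) : Realization A where
  index := X.index ⊕ Y.index
  row := Matrix.fromCols X.row Y.row
  mat := Matrix.fromBlocks X.mat 0 0 Y.mat
  col := Matrix.fromRows X.col Y.col

/-- The product of realizations. -/
def mul (X Y : Realization A) : Realization A where
  index := X.index ⊕ Y.index
  row := Matrix.fromCols X.row 0
  -- The evident system for the product has the constant block `-gf'` in the upper right corner, so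
  -- it is not of the form `1 - Mx`. Adding `gf'` times the second row to the first replaces that
  -- block by `-gf'α'x` and puts `gf'g'` into the column.
  mat := Matrix.fromBlocks X.mat (X.col * Y.row * Y.mat) 0 Y.mat
  col := Matrix.fromRows (X.col * Y.row * Y.col) Y.col

theorem Rel.add_left {X X' : Realization A} (Y : Realization A) :
    Rel X X' → Rel (X.add Y) (X'.add Y) := by
  rintro ⟨φ, h, hf, hg⟩
  refine Rel.ofTriple (Matrix.fromBlocks φ 0 0 1) ?_ ?_ ?_
  · simp [Matrix.fromBlocks_multiply, h]
  · simp [Matrix.fromCols_mul_fromBlocks, hf]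
  · simp [Matrix.fromBlocks_mul_fromRows, hg]

theorem Rel.add_right {X X' : Realization A} (Y : Realization A) :
    Rel X X' → Rel (Y.add X) (Y.add X') := by
  rintro ⟨φ, h, hf, hg⟩
  refine Rel.ofTriple (Matrix.fromBlocks 1 0 0 φ) ?_ ?_ ?_
  · simp [Matrix.fromBlocks_multiply, h]
  · simp [Matrix.fromCols_mul_fromBlocks, hf]
  · simp [Matrix.fromBlocks_mul_fromRows, hg]

theorem Rel.mul_left {X X' : Realization A} (Y : Realization A) :
    Rel X X' → Rel (X.mul Y) (X'.mul Y) := by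
  rintro ⟨φ, h, hf, hg⟩
  refine Rel.ofTriple (Matrix.fromBlocks φ 0 0 1) ?_ ?_ ?_
  · simp [Matrix.fromBlocks_multiply, h, hg, Matrix.mul_assoc]
  · simp [Matrix.fromCols_mul_fromBlocks, hf]
  · simp [Matrix.fromBlocks_mul_fromRows, hg, Matrix.mul_assoc]

theorem Rel.mul_right {X X' : Realization A} (Y : Realization A) :
    Rel X X' → Rel (Y.mul X) (Y.mul X') := by
  rintro ⟨φ, h, hf, hg⟩
  refine Rel.ofTriple (Matrix.fromBlocks 1 0 0 φ) ?_ ?_ ?_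
  · simp [Matrix.fromBlocks_multiply, h, ← hf, Matrix.mul_assoc]
  · simp [Matrix.fromCols_mul_fromBlocks]
  · simp [Matrix.fromBlocks_mul_fromRows, hg, ← hf, Matrix.mul_assoc]

/-- `(f, α, g) ↦ (-f, α, g)`. -/
def neg (X : Realization A) : Realization A where
  index := X.index
  row := -X.row
  mat := X.mat
  col := X.col

theorem Rel.neg {X X' : Realization A} : Rel X X' → Rel X.neg X'.neg := by
  rintro ⟨φ, h, hf, hg⟩
  exact Rel.ofTriple φ h (by rw [Matrix.neg_mul, hf]) hg

namespace Rational

instance : Add (Rational A) :=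
  ⟨Quot.map₂ add (fun X _ _ h => h.add_right X) (fun _ _ Y h => h.add_left Y)⟩

instance : Mul (Rational A) :=
  ⟨Quot.map₂ mul (fun X _ _ h => h.mul_right X) (fun _ _ Y h => h.mul_left Y)⟩

instance : Neg (Rational A) := ⟨Quot.map neg fun _ _ h => h.neg⟩

instance : Zero (Rational A) := ⟨mk (κ := Empty) 0 0 0⟩

instance : One (Rational A) := ⟨mk (κ := Unit) 1 0 1⟩

end Rational

section

variable {κ l m : Type} [Fintype κ] [DecidableEq κ] [Fintype l] [DecidableEq l] [Fintype m]
  [DecidableEq m] (f : Matrix Unit κ A) (α : Matrix κ κ A) (g : Matrix κ Unit A)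
  (f' : Matrix Unit l A) (α' : Matrix l l A) (g' : Matrix l Unit A)
  (f'' : Matrix Unit m A) (α'' : Matrix m m A) (g'' : Matrix m Unit A)

theorem mk_add_mk : mk f α g + mk f' α' g' =
    mk (Matrix.fromCols f f') (Matrix.fromBlocks α 0 0 α') (Matrix.fromRows g g') := rfl

theorem mk_mul_mk : mk f α g * mk f' α' g' =
    mk (Matrix.fromCols f 0) (Matrix.fromBlocks α (g * f' * α') 0 α')
      (Matrix.fromRows (g * f' * g') g') := rfl

theorem neg_mk : -mk f α g = mk (-f) α g := rfl

theorem mk_zero_left : mk 0 α g = 0 :=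
  (mk_eq (κ := Empty) 0 (Subsingleton.elim _ _) (by simp) (Subsingleton.elim _ _)).symm

/-- Here `φ` is the folding map of two copies of `κ`; for sums in the column, the diagonal plays
this role. Together they make a triple biadditive in its row and column. -/
theorem mk_add_left (f₁ f₂ : Matrix Unit κ A) : mk f₁ α g + mk f₂ α g = mk (f₁ + f₂) α g := by
  rw [mk_add_mk]
  refine mk_eq (Matrix.fromRows 1 1) ?_ ?_ ?_
  · simp [Matrix.fromBlocks_mul_fromRows, Matrix.fromRows_mul]
  · simp [Matrix.fromCols_mul_fromRows]
  · simp [Matrix.fromRows_mul]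

theorem mk_add_right (g₁ g₂ : Matrix κ Unit A) : mk f α g₁ + mk f α g₂ = mk f α (g₁ + g₂) := by
  rw [mk_add_mk]
  refine (mk_eq (Matrix.fromCols 1 1) ?_ ?_ ?_).symm
  · simp [Matrix.fromCols_mul_fromBlocks, Matrix.mul_fromCols]
  · simp [Matrix.mul_fromCols]
  · simp [Matrix.fromCols_mul_fromRows]

theorem mk_add_assoc : mk f α g + mk f' α' g' + mk f'' α'' g'' =
    mk f α g + (mk f' α' g' + mk f'' α'' g'') := by
  simp only [mk_add_mk]
  -- `φ` is the permutation matrix reassociating the threefold sum of index sets; the same matrix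
  -- serves for products.
  refine mk_eq (Matrix.fromRows (Matrix.fromBlocks 1 0 0 (Matrix.fromCols 1 0))
    (Matrix.fromCols 0 (Matrix.fromCols 0 1))) ?_ ?_ ?_ <;>
  simp [Matrix.fromBlocks_mul_fromRows, Matrix.fromRows_mul, Matrix.fromBlocks_multiply,
    Matrix.fromCols_mul_fromRows, Matrix.fromCols_mul_fromBlocks, Matrix.mul_fromCols,
    Matrix.fromCols_add_fromCols]

theorem mk_mul_assoc : mk f α g * mk f' α' g' * mk f'' α'' g'' =
    mk f α g * (mk f' α' g' * mk f'' α'' g'') := by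
  simp only [mk_mul_mk]
  refine mk_eq (Matrix.fromRows (Matrix.fromBlocks 1 0 0 (Matrix.fromCols 1 0))
    (Matrix.fromCols 0 (Matrix.fromCols 0 1))) ?_ ?_ ?_
  · simp only [Matrix.fromBlocks_mul_fromRows, Matrix.fromRows_mul, Matrix.fromBlocks_multiply,
      Matrix.fromCols_mul_fromBlocks, Matrix.mul_fromCols, Matrix.mul_assoc]
    ext ((_ | _) | _) (_ | _ | _) <;> simp
  · simp [Matrix.fromCols_mul_fromRows, Matrix.fromCols_mul_fromBlocks]
  · simp [Matrix.fromBlocks_mul_fromRows, Matrix.fromRows_mul, Matrix.fromCols_mul_fromRows,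
      Matrix.mul_assoc]

theorem mk_mul_add : mk f α g * (mk f' α' g' + mk f'' α'' g'') =
    mk f α g * mk f' α' g' + mk f α g * mk f'' α'' g'' := by
  simp only [mk_mul_mk, mk_add_mk]
  -- `φ` duplicates the block of the left factor; in the other distributive law it folds the two
  -- copies of the right factor.
  refine mk_eq (Matrix.fromBlocks (Matrix.fromCols 1 0) (Matrix.fromCols 1 0)
    (Matrix.fromRows (Matrix.fromCols 0 1) 0) (Matrix.fromRows 0 (Matrix.fromCols 0 1)))
    ?_ ?_ ?_ <;>
  simp [Matrix.fromBlocks_mul_fromRows, Matrix.fromRows_mul, Matrix.fromBlocks_multiply,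
    Matrix.fromCols_mul_fromRows, Matrix.fromCols_mul_fromBlocks, Matrix.mul_fromCols,
    Matrix.mul_assoc, Matrix.fromCols_add_fromCols, Matrix.fromRows_add_fromRows]

theorem mk_add_mul : (mk f α g + mk f' α' g') * mk f'' α'' g'' =
    mk f α g * mk f'' α'' g'' + mk f' α' g' * mk f'' α'' g'' := by
  simp only [mk_mul_mk, mk_add_mk]
  refine (mk_eq (Matrix.fromBlocks (Matrix.fromRows (Matrix.fromCols 1 0) 0)
    (Matrix.fromRows 0 1) (Matrix.fromRows (Matrix.fromCols 0 1) 0) (Matrix.fromRows 0 1))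
    ?_ ?_ ?_).symm <;>
  simp [Matrix.fromBlocks_mul_fromRows, Matrix.fromRows_mul, Matrix.fromBlocks_multiply,
    Matrix.fromCols_mul_fromRows, Matrix.fromCols_mul_fromBlocks, Matrix.mul_fromCols,
    Matrix.mul_assoc, Matrix.fromCols_add_fromCols, Matrix.fromRows_add_fromRows]

theorem one_mul_mk : 1 * mk f α g = mk f α g := by
  change mk 1 0 1 * _ = _
  rw [mk_mul_mk]
  refine mk_eq (Matrix.fromRows f 1) ?_ ?_ ?_ <;>
  simp [Matrix.fromBlocks_mul_fromRows, Matrix.fromRows_mul, Matrix.fromCols_mul_fromRows]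

theorem mk_mul_one : mk f α g * 1 = mk f α g := by
  change _ * mk 1 0 1 = _
  rw [mk_mul_mk]
  refine (mk_eq (Matrix.fromCols 1 0) ?_ ?_ ?_).symm <;>
  simp [Matrix.fromCols_mul_fromBlocks, Matrix.mul_fromCols, Matrix.fromCols_mul_fromRows]

theorem zero_add_mk : 0 + mk f α g = mk f α g := by
  rw [← mk_zero_left α g, mk_add_left, zero_add]

theorem neg_add_mk : -mk f α g + mk f α g = 0 := by
  rw [neg_mk, mk_add_left, neg_add_cancel, mk_zero_left]

end

instance : Ring (Rational A) :=
  Ring.ofMinimalAxioms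
    (fun a b c => by
      induction a using Rational.ind
      induction b using Rational.ind
      induction c using Rational.ind
      exact mk_add_assoc ..)
    (fun a => by
      induction a using Rational.ind
      exact zero_add_mk ..)
    (fun a => by
      induction a using Rational.ind
      exact neg_add_mk ..)
    (fun a b c => by
      induction a using Rational.ind
      induction b using Rational.ind
      induction c using Rational.ind
      exact mk_mul_assoc ..)
    (fun a => by
      induction a using Rational.ind
      exact one_mul_mk ..)
    (fun a => by
      induction a using Rational.ind
      exact mk_mul_one ..)
    (fun a b c => by
      induction a using Rational.ind
      induction b using Rational.ind
      induction c using Rational.ind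
      exact mk_mul_add ..)
    (fun a b c => by
      induction a using Rational.ind
      induction b using Rational.ind
      induction c using Rational.ind
      exact mk_add_mul ..)

/-! ### Evaluation of realizations -/

/-- A ring `S` in which realizations can be evaluated: a homomorphism `A → S` and an element `x`
commuting with its image such that all matrices `1 - αx` are invertible. -/
structure Evaluation (A S : Type*) [Ring A] [Ring S] where
  /-- The homomorphism `A → S`. -/
  coeff : A →+* S
  /-- The element `x`. -/
  var : S
  comm : ∀ a, Commute (coeff a) var
  isUnit : ∀ {κ : Type} [Fintype κ] [DecidableEq κ] (α : Matrix κ κ A),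
    IsUnit (1 - α.map fun a => coeff a * var)

section pencil

variable {S : Type*} [Ring S] (c : A →+* S) (x : S) {κ l m : Type*} [Fintype κ]

theorem map_mul_mapVar (M : Matrix m κ A) (N : Matrix κ l A) :
    M.map c * N.map (fun a => c a * x) = (M * N).map fun a => c a * x := by
  ext i j
  simp [Matrix.mul_apply, Finset.sum_mul, mul_assoc]

theorem mapVar_mul_map (hx : ∀ a, Commute (c a) x) (M : Matrix m κ A) (N : Matrix κ l A) :
    M.map (fun a => c a * x) * N.map c = (M * N).map fun a => c a * x := by
  ext i j
  simp only [Matrix.mul_apply, Matrix.map_apply, map_sum, map_mul, Finset.sum_mul, mul_assoc]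
  exact Finset.sum_congr rfl fun k _ => by rw [(hx _).eq]

theorem mapVar_sub (M N : Matrix m l A) : (M - N).map (fun a => c a * x) =
    M.map (fun a => c a * x) - N.map (fun a => c a * x) := by
  ext i j
  simp [sub_mul]

/-- The matrix `1 - αx`. -/
def pencil [DecidableEq κ] (α : Matrix κ κ A) : Matrix κ κ S := 1 - α.map fun a => c a * x

variable {c x}

theorem pencil_mul_map (hx : ∀ a, Commute (c a) x) [Fintype l] [DecidableEq κ] [DecidableEq l]
    {α : Matrix κ κ A} {β : Matrix l l A} {φ : Matrix κ l A} (h : α * φ = φ * β) :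
    pencil c x α * φ.map c = φ.map c * pencil c x β := by
  rw [pencil, pencil, Matrix.sub_mul, Matrix.mul_sub, mapVar_mul_map c x hx, map_mul_mapVar, h,
    Matrix.one_mul, Matrix.mul_one]

end pencil

namespace Evaluation

variable {S : Type*} [Ring S] (E : Evaluation A S)

/-- The value `f (1 - αx)⁻¹ g` of a realization. -/
noncomputable def value {κ : Type} [Fintype κ] [DecidableEq κ] (f : Matrix Unit κ A)
    (α : Matrix κ κ A) (g : Matrix κ Unit A) : Matrix Unit Unit S :=
  f.map E.coeff * (Ring.inverse (pencil E.coeff E.var α) * g.map E.coeff)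

theorem pencil_fromBlocks {κ l : Type} [DecidableEq κ] [DecidableEq l] (α : Matrix κ κ A)
    (β : Matrix κ l A) (γ : Matrix l κ A) (δ : Matrix l l A) : pencil E.coeff E.var (Matrix.fromBlocks α β γ δ) =
      Matrix.fromBlocks (pencil E.coeff E.var α) (-β.map fun a => E.coeff a * E.var)
        (-γ.map fun a => E.coeff a * E.var) (pencil E.coeff E.var δ) := by
  rw [pencil, Matrix.fromBlocks_map, ← Matrix.fromBlocks_one, sub_eq_add_neg,
    Matrix.fromBlocks_neg, Matrix.fromBlocks_add]
  simp [pencil, sub_eq_add_neg]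

section

variable {κ l : Type} [Fintype κ] [DecidableEq κ] [Fintype l] [DecidableEq l]

theorem inverse_mul_pencil (α : Matrix κ κ A) :
    Ring.inverse (pencil E.coeff E.var α) * pencil E.coeff E.var α = 1 :=
  Ring.inverse_mul_cancel _ (E.isUnit α)

theorem pencil_mul_inverse (α : Matrix κ κ A) :
    pencil E.coeff E.var α * Ring.inverse (pencil E.coeff E.var α) = 1 :=
  Ring.mul_inverse_cancel _ (E.isUnit α)

theorem pencil_mul_inverse_mul {ι : Type} (α : Matrix κ κ A) (g : Matrix κ ι S) :
    pencil E.coeff E.var α * (Ring.inverse (pencil E.coeff E.var α) * g) = g := by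
  rw [← Matrix.mul_assoc, pencil_mul_inverse, Matrix.one_mul]

theorem inverse_mul_eq {ι : Type} {α : Matrix κ κ A} {w : Matrix κ ι S} {g : Matrix κ ι S}
    (h : pencil E.coeff E.var α * w = g) : Ring.inverse (pencil E.coeff E.var α) * g = w := by
  rw [← h, ← Matrix.mul_assoc, inverse_mul_pencil, Matrix.one_mul]

theorem value_eq {f : Matrix Unit κ A} {α : Matrix κ κ A} {g : Matrix κ Unit A}
    {w : Matrix κ Unit S} (h : pencil E.coeff E.var α * w = g.map E.coeff) :
    E.value f α g = f.map E.coeff * w := by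
  rw [value, E.inverse_mul_eq h]

theorem value_congr {f : Matrix Unit κ A} {α : Matrix κ κ A} {g : Matrix κ Unit A}
    {f' : Matrix Unit l A} {α' : Matrix l l A} {g' : Matrix l Unit A} (φ : Matrix κ l A)
    (h : α * φ = φ * α') (hf : f * φ = f') (hg : g = φ * g') :
    E.value f α g = E.value f' α' g' := by
  rw [E.value_eq (w := φ.map E.coeff * (Ring.inverse (pencil E.coeff E.var α') * g'.map E.coeff)),
    ← Matrix.mul_assoc, ← Matrix.map_mul, hf, value]
  rw [← Matrix.mul_assoc, pencil_mul_map E.comm h, Matrix.mul_assoc,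
    ← Matrix.mul_assoc _ _ (g'.map _),
    pencil_mul_inverse, Matrix.one_mul, hg, Matrix.map_mul]

theorem value_add (f : Matrix Unit κ A) (α : Matrix κ κ A) (g : Matrix κ Unit A)
    (f' : Matrix Unit l A) (α' : Matrix l l A) (g' : Matrix l Unit A) :
    E.value (Matrix.fromCols f f') (Matrix.fromBlocks α 0 0 α') (Matrix.fromRows g g') =
      E.value f α g + E.value f' α' g' := by
  rw [E.value_eq (w := Matrix.fromRows (Ring.inverse (pencil E.coeff E.var α) * g.map E.coeff)
    (Ring.inverse (pencil E.coeff E.var α') * g'.map E.coeff)), Matrix.fromCols_map,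
    Matrix.fromCols_mul_fromRows, value, value]
  rw [pencil_fromBlocks, Matrix.fromBlocks_mul_fromRows, pencil_mul_inverse_mul,
    pencil_mul_inverse_mul, Matrix.fromRows_map]
  simp [Matrix.map_zero]

/-- Back substitution in the block triangular system: the second block of the solution is `w' = (1 -
α'x)⁻¹g'`, and `α'xw' = w' - g'` makes the first block `(1 - αx)⁻¹gf'w'`. -/
theorem value_mul (f : Matrix Unit κ A) (α : Matrix κ κ A) (g : Matrix κ Unit A)
    (f' : Matrix Unit l A) (α' : Matrix l l A) (g' : Matrix l Unit A) :
    E.value (Matrix.fromCols f 0) (Matrix.fromBlocks α (g * f' * α') 0 α')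
      (Matrix.fromRows (g * f' * g') g') = E.value f α g * E.value f' α' g' := by
  set w' := Ring.inverse (pencil E.coeff E.var α') * g'.map E.coeff with hw'
  have h' : pencil E.coeff E.var α' * w' = g'.map E.coeff := by
    rw [hw', pencil_mul_inverse_mul]
  have h'' : α'.map (fun a => E.coeff a * E.var) * w' = w' - g'.map E.coeff := by
    rw [← h', pencil, Matrix.sub_mul, Matrix.one_mul, sub_sub_cancel]
  rw [E.value_eq (w := Matrix.fromRows (Ring.inverse (pencil E.coeff E.var α) *
    (g.map E.coeff * (f'.map E.coeff * w'))) w'), Matrix.fromCols_map,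
    Matrix.fromCols_mul_fromRows, value, value, ← hw']
  · simp [Matrix.map_zero, Matrix.mul_assoc]
  · rw [pencil_fromBlocks, Matrix.fromBlocks_mul_fromRows, pencil_mul_inverse_mul, h',
      ← map_mul_mapVar, Matrix.neg_mul, Matrix.mul_assoc _ _ w', h'',
      Matrix.fromRows_map]
    simp only [Matrix.map_mul, Matrix.mul_sub, Matrix.mul_assoc]
    simp [Matrix.map_zero]

end

/-- The evaluation homomorphism. -/
noncomputable def eval : Rational A →+* S :=
  RingHom.mk' ⟨⟨Quot.lift (fun X => E.value X.row X.mat X.col () ())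
      (fun X Y ⟨φ, h, hf, hg⟩ => congrFun (congrFun (E.value_congr φ h hf hg) ()) ()), by
      change E.value 1 0 1 () () = 1
      rw [E.value_eq (w := 1)] <;> simp [pencil, Matrix.map_zero]⟩, by
      intro a b
      induction a using Rational.ind
      induction b using Rational.ind
      refine (congrFun (congrFun (E.value_mul ..) ()) ()).trans ?_
      simp only [Matrix.mul_apply, Finset.univ_unique, Finset.sum_singleton]
      rfl⟩ (by
      intro a b
      induction a using Rational.ind
      induction b using Rational.ind
      exact congrFun (congrFun (E.value_add ..) ()) ())

theorem eval_mk {κ : Type} [Fintype κ] [DecidableEq κ] (f : Matrix Unit κ A)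
    (α : Matrix κ κ A) (g : Matrix κ Unit A) :
    E.eval (Realization.mk f α g) = E.value f α g () () := rfl

end Evaluation

/-! ### The constants, the variable and the resolvent -/

section

variable {κ : Type} [Fintype κ] [DecidableEq κ]

/-- The homomorphism `A → Rational A`. -/
def const : A →+* Rational A :=
  RingHom.mk' ⟨⟨fun a => mk (Matrix.scalar Unit a) 0 1, by rw [map_one]; rfl⟩, by
    intro a b
    change mk (Matrix.scalar Unit (a * b)) 0 1 = mk _ 0 1 * mk _ 0 1
    rw [map_mul, mk_mul_mk]
    refine (mk_eq (Matrix.fromRows (Matrix.scalar Unit b) 1) ?_ ?_ ?_).symm <;>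
    simp [Matrix.fromCols_mul_fromRows]⟩ (by
    intro a b
    change mk (Matrix.scalar Unit (a + b)) 0 1 = mk _ 0 1 + mk _ 0 1
    rw [mk_add_left, map_add])

theorem const_apply (a : A) : const a = mk (Matrix.scalar Unit a) 0 1 := rfl

theorem scalar_unit (p : Matrix Unit Unit A) : Matrix.scalar Unit (p () ()) = p := by
  ext
  simp

theorem const_unit (p : Matrix Unit Unit A) : const (p () ()) = mk p 0 1 := by
  rw [const_apply, scalar_unit]

theorem const_mul_mk (a : A) (f : Matrix Unit κ A) (α : Matrix κ κ A) (g : Matrix κ Unit A) :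
    const a * mk f α g = mk (Matrix.scalar Unit a * f) α g := by
  rw [const_apply, mk_mul_mk]
  refine mk_eq (Matrix.fromRows f 1) ?_ ?_ ?_ <;>
  simp [Matrix.fromBlocks_mul_fromRows, Matrix.fromRows_mul, Matrix.fromCols_mul_fromRows]

theorem mk_mul_const (a : A) (f : Matrix Unit κ A) (α : Matrix κ κ A) (g : Matrix κ Unit A) :
    mk f α g * const a = mk f α (g * Matrix.scalar Unit a) := by
  rw [const_apply, mk_mul_mk]
  refine (mk_eq (Matrix.fromCols 1 0) ?_ ?_ ?_).symm <;>
  simp [Matrix.fromCols_mul_fromBlocks, Matrix.mul_fromCols, Matrix.fromCols_mul_fromRows]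

variable (A) in
/-- The variable `x`. -/
def X : Rational A :=
  -- The square matrix `N` has `N² = 0`, so `(1 - Nx)⁻¹ = 1 + Nx`; the row and column extract the
  -- entry `x`.
  mk (Matrix.fromCols (1 : Matrix Unit Unit A) (0 : Matrix Unit Unit A))
    (Matrix.fromBlocks 0 1 0 0) (Matrix.fromRows 0 1)

theorem X_mul_mk (f : Matrix Unit κ A) (α : Matrix κ κ A) (g : Matrix κ Unit A) :
    X A * mk f α g = mk (Matrix.fromCols (1 : Matrix Unit Unit A) 0)
      (Matrix.fromBlocks 0 f 0 α) (Matrix.fromRows 0 g) := by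
  rw [X, mk_mul_mk]
  refine mk_eq (Matrix.fromRows (Matrix.fromBlocks 1 0 0 f) (Matrix.fromCols 0 1)) ?_ ?_ ?_
  · simp only [Matrix.fromBlocks_mul_fromRows, Matrix.fromRows_mul, Matrix.fromBlocks_multiply,
      Matrix.fromCols_mul_fromBlocks, Matrix.mul_fromCols]
    ext ((_ | _) | _) (_ | _) <;> simp
  · simp [Matrix.fromCols_mul_fromRows, Matrix.fromCols_mul_fromBlocks]
  · simp [Matrix.fromBlocks_mul_fromRows, Matrix.fromRows_mul, Matrix.fromCols_mul_fromRows]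

theorem mk_mul_X (f : Matrix Unit κ A) (α : Matrix κ κ A) (g : Matrix κ Unit A) :
    mk f α g * X A = mk (Matrix.fromCols f (0 : Matrix Unit Unit A))
      (Matrix.fromBlocks α g 0 0) (Matrix.fromRows 0 1) := by
  rw [X, mk_mul_mk]
  refine (mk_eq (Matrix.fromBlocks 1 0 0 (Matrix.fromCols 0 1)) ?_ ?_ ?_).symm
  · simp only [Matrix.fromBlocks_multiply, Matrix.fromCols_mul_fromBlocks, Matrix.mul_fromCols]
    ext (_ | _) (_ | _ | _) <;> simp
  · simp [Matrix.fromCols_mul_fromBlocks]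
  · simp [Matrix.fromBlocks_mul_fromRows, Matrix.fromCols_mul_fromRows]

theorem commute_const_X (a : A) : Commute (const a) (X A) := by
  rw [Commute, SemiconjBy, X, const_mul_mk, mk_mul_const]
  refine (mk_eq (Matrix.fromBlocks (Matrix.scalar Unit a) 0 0 (Matrix.scalar Unit a))
    ?_ ?_ ?_).symm
  · rw [Matrix.fromBlocks_multiply, Matrix.fromBlocks_multiply]
    simp
  · rw [Matrix.fromCols_mul_fromBlocks, Matrix.mul_fromCols]
    simp
  · rw [Matrix.fromBlocks_mul_fromRows, Matrix.fromRows_mul]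
    simp

/-- The first step of the geometric expansion of `(1 - αx)⁻¹`. Together with its mirror image it
makes the triples with unit rows and columns a two-sided inverse of `1 - αx`. -/
theorem mk_eq_const_add_X_mul (f : Matrix Unit κ A) (α : Matrix κ κ A) (g : Matrix κ Unit A) :
    mk f α g = const ((f * g) () ()) + X A * mk (f * α) α g := by
  -- The constant is realized again over the square matrix that realizes the other summand, so that
  -- the sum can be taken in the column alone.
  have h1 : mk (Matrix.fromCols (1 : Matrix Unit Unit A) 0) (Matrix.fromBlocks 0 (f * α) 0 α)
      (Matrix.fromRows (f * g) 0) = mk (f * g) 0 (1 : Matrix Unit Unit A) := by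
    refine (mk_eq (Matrix.fromRows 1 0) ?_ ?_ ?_).trans
      ((mk_eq (f := (1 : Matrix Unit Unit A)) (α := 0) (g := f * g) (f * g) ?_ ?_ ?_)) <;>
    simp [Matrix.fromBlocks_mul_fromRows, Matrix.fromCols_mul_fromRows, Matrix.fromRows_mul]
  rw [const_unit, X_mul_mk, ← h1, mk_add_right]
  refine (mk_eq (Matrix.fromRows f 1) ?_ ?_ ?_).symm <;>
  simp [Matrix.fromBlocks_mul_fromRows, Matrix.fromCols_mul_fromRows, Matrix.fromRows_mul,
    Matrix.fromRows_add_fromRows]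

theorem mk_eq_const_add_mul_X (f : Matrix Unit κ A) (α : Matrix κ κ A) (g : Matrix κ Unit A) :
    mk f α g = const ((f * g) () ()) + mk f α (α * g) * X A := by
  have h1 : mk (f * g) 0 1 = mk (Matrix.fromCols 0 (f * g))
      (Matrix.fromBlocks α (α * g) 0 (0 : Matrix Unit Unit A)) (Matrix.fromRows 0 1) := by
    refine mk_eq (Matrix.fromCols 0 1) ?_ ?_ ?_ <;>
    simp [Matrix.fromCols_mul_fromBlocks, Matrix.fromCols_mul_fromRows, Matrix.mul_fromCols]
  rw [const_unit, mk_mul_X, h1, mk_add_left]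
  refine mk_eq (Matrix.fromCols 1 g) ?_ ?_ ?_ <;>
  simp [Matrix.fromCols_mul_fromBlocks, Matrix.fromCols_mul_fromRows, Matrix.mul_fromCols,
    Matrix.fromCols_add_fromCols]

/-- The matrix over `Rational A` realized by matrices `F`, `α` and `G`. -/
def realize {ι ι' : Type} (F : Matrix ι κ A) (α : Matrix κ κ A) (G : Matrix κ ι' A) :
    Matrix ι ι' (Rational A) :=
  Matrix.of fun i j => mk (F.submatrix (fun _ => i) id) α (G.submatrix id fun _ => j)

theorem map_const_mul_realize {n ι ι' : Type} [Fintype ι] (M : Matrix n ι A)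
    (F : Matrix ι κ A) (α : Matrix κ κ A)
    (G : Matrix κ ι' A) : M.map const * realize F α G = realize (M * F) α G := by
  ext i j
  let L : Matrix Unit κ A →+ Rational A :=
    AddMonoidHom.mk' (fun f => mk f α (G.submatrix id fun _ => j))
      fun f f' => (mk_add_left α _ f f').symm
  rw [Matrix.mul_apply]
  simp only [Matrix.map_apply, realize, Matrix.of_apply, const_mul_mk]
  refine (map_sum L _ _).symm.trans (congrArg L ?_)
  ext u k
  simp [Matrix.sum_apply, Matrix.mul_apply]

theorem realize_mul_map_const {n ι ι' : Type} [Fintype ι'] (M : Matrix ι' n A) (F : Matrix ι κ A)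
    (α : Matrix κ κ A) (G : Matrix κ ι' A) :
    realize F α G * M.map const = realize F α (G * M) := by
  ext i j
  let L : Matrix κ Unit A →+ Rational A :=
    AddMonoidHom.mk' (fun g => mk (F.submatrix (fun _ => i) id) α g)
      fun g g' => (mk_add_right _ α g g').symm
  rw [Matrix.mul_apply]
  simp only [Matrix.map_apply, realize, Matrix.of_apply, mk_mul_const]
  refine (map_sum L _ _).symm.trans (congrArg L ?_)
  ext k u
  simp [Matrix.sum_apply, Matrix.mul_apply]

theorem realize_eq_map_const_add_X_mul {ι ι' : Type} (F : Matrix ι κ A)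
    (α : Matrix κ κ A) (G : Matrix κ ι' A) :
    realize F α G = (F * G).map const + (realize (F * α) α G).map (X A * ·) := by
  ext i j
  exact mk_eq_const_add_X_mul _ _ _

theorem realize_eq_map_const_add_mul_X {ι ι' : Type} (F : Matrix ι κ A)
    (α : Matrix κ κ A) (G : Matrix κ ι' A) :
    realize F α G = (F * G).map const + (realize F α (α * G)).map (· * X A) := by
  ext i j
  exact mk_eq_const_add_mul_X _ _ _

theorem pencil_mul_realize (α : Matrix κ κ A) : pencil const (X A) α * realize 1 α 1 = 1 := by
  have h : α.map (fun a => const a * X A) * realize 1 α 1 =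
      (realize (1 * α) α 1).map (X A * ·) := by
    rw [Matrix.one_mul, ← Matrix.mul_one α, ← map_const_mul_realize, Matrix.mul_one]
    ext i j
    simp only [Matrix.mul_apply, Matrix.map_apply, Finset.mul_sum, ← mul_assoc,
      (commute_const_X _).eq]
  rw [pencil, Matrix.sub_mul, h, Matrix.one_mul, sub_eq_iff_eq_add,
    realize_eq_map_const_add_X_mul 1 α 1, Matrix.mul_one, Matrix.map_ringHom_one]

theorem realize_mul_pencil (α : Matrix κ κ A) : realize 1 α 1 * pencil const (X A) α = 1 := by
  have h : realize 1 α 1 * α.map (fun a => const a * X A) =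
      (realize 1 α (α * 1)).map (· * X A) := by
    rw [Matrix.mul_one, ← Matrix.one_mul α, ← realize_mul_map_const, Matrix.one_mul]
    ext i j
    simp only [Matrix.mul_apply, Matrix.map_apply, Finset.sum_mul, mul_assoc]
  rw [pencil, Matrix.mul_sub, h, Matrix.mul_one, sub_eq_iff_eq_add,
    realize_eq_map_const_add_mul_X 1 α 1, Matrix.mul_one, Matrix.map_ringHom_one]

theorem isUnit_pencil_const (α : Matrix κ κ A) : IsUnit (pencil const (X A) α) :=
  ⟨⟨_, _, pencil_mul_realize α, realize_mul_pencil α⟩, rfl⟩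

/-- A triple is the value of the expression it stands for, computed inside the ring of triples. So a
homomorphism out of this ring is determined by the constants and `x`. -/
theorem mk_eq_map_const_mul (f : Matrix Unit κ A) (α : Matrix κ κ A) (g : Matrix κ Unit A) :
    (Matrix.of fun _ _ => mk f α g : Matrix Unit Unit (Rational A)) =
      f.map const * (realize (1 : Matrix κ κ A) α (1 : Matrix κ κ A) * g.map const) := by
  rw [realize_mul_map_const, map_const_mul_realize, Matrix.mul_one, Matrix.one_mul]
  rfl

/-! ### The augmentation -/

variable (A) in
/-- Evaluation at `x = 0`. -/
def evaluationZero : Evaluation A A where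
  coeff := RingHom.id A
  var := 0
  comm := Commute.zero_right
  isUnit α := by
    convert isUnit_one
    ext
    simp

variable (A) in
/-- The augmentation `f (1 - αx)⁻¹ g ↦ f g`. -/
noncomputable def augmentation : Rational A →+* A := (evaluationZero A).eval

theorem augmentation_mk (f : Matrix Unit κ A) (α : Matrix κ κ A) (g : Matrix κ Unit A) :
    augmentation A (mk f α g) = (f * g) () () := by
  rw [augmentation, Evaluation.eval_mk, Evaluation.value_eq (w := g)]
  · simp [evaluationZero]
  · have h : pencil (evaluationZero A).coeff (evaluationZero A).var α = 1 := by
      ext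
      simp [evaluationZero, pencil]
    rw [h, Matrix.one_mul]
    ext
    simp [evaluationZero]

theorem augmentation_const (a : A) : augmentation A (const a) = a := by
  simp [const_apply, augmentation_mk]

theorem augmentation_X : augmentation A (X A) = 0 := by
  simp [X, augmentation_mk, Matrix.fromCols_mul_fromRows]

/-- With `R = (1 - αx)⁻¹` and `U = fαxR`, the condition `f g = 1` gives `f R g = 1 + Ug`. The
swapped matrix `1 + gU = (1 - (α - gfα)x)R` is a product of invertible matrices, and invertibility
passes from `1 + gU` to `1 + Ug`. -/
theorem isUnit_mk {f : Matrix Unit κ A} (α : Matrix κ κ A) {g : Matrix κ Unit A}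
    (h : f * g = 1) : IsUnit (mk f α g) := by
  set R := realize (1 : Matrix κ κ A) α (1 : Matrix κ κ A) with hR
  set U := (f * α).map (fun a => const a * X A) * R with hU
  have hR1 : R = 1 + α.map (fun a => const a * X A) * R := by
    have := pencil_mul_realize α
    rw [pencil, Matrix.sub_mul, Matrix.one_mul, sub_eq_iff_eq_add] at this
    exact this
  have h1 : (Matrix.of fun _ _ => mk f α g : Matrix Unit Unit (Rational A)) =
      1 + U * g.map const := by
    rw [mk_eq_map_const_mul, ← hR, ← Matrix.mul_assoc]
    nth_rewrite 1 [hR1]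
    rw [Matrix.mul_add, Matrix.mul_one, ← Matrix.mul_assoc, map_mul_mapVar, Matrix.add_mul,
      ← Matrix.map_mul, h, Matrix.map_ringHom_one]
  have h2 : 1 + g.map const * U = pencil const (X A) (α - g * (f * α)) * R := by
    rw [pencil, mapVar_sub, ← sub_add, Matrix.add_mul, ← pencil, pencil_mul_realize, hU,
      ← Matrix.mul_assoc, map_mul_mapVar]
  have h3 : IsUnit (1 + g.map const * U) := by
    rw [h2]
    exact (isUnit_pencil_const _).mul ⟨⟨_, _, realize_mul_pencil α, pencil_mul_realize α⟩, rfl⟩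
  obtain ⟨⟨_, q, hq, hq'⟩, rfl⟩ := h3
  have e1 := Matrix.one_add_mul_sylvester hq
  have e2 := Matrix.one_add_mul_sylvester' hq'
  rw [← h1] at e1 e2
  refine isUnit_iff_exists.mpr
    ⟨(1 - U * q * g.map const : Matrix Unit Unit (Rational A)) () (), ?_, ?_⟩
  · simpa [Matrix.mul_apply] using congrFun (congrFun e1 ()) ()
  · simpa [Matrix.mul_apply] using congrFun (congrFun e2 ()) ()

theorem isUnit_of_augmentation_eq_one {b : Rational A} (h : augmentation A b = 1) : IsUnit b := by
  induction b using Rational.ind with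
  | h κ f α g =>
    rw [augmentation_mk] at h
    exact isUnit_mk α (by ext; simpa using h)

instance : IsLocalHom (augmentation A) where
  map_nonunit b := by
    rintro ⟨u, hu⟩
    have h : IsUnit (const ((u⁻¹ : Aˣ) : A) * b) := isUnit_of_augmentation_eq_one (by
      rw [map_mul, augmentation_const, ← hu, Units.inv_mul])
    have h' : const (u : A) * (const ((u⁻¹ : Aˣ) : A) * b) = b := by
      rw [← mul_assoc, ← map_mul, Units.mul_inv, map_one, one_mul]
    rw [← h']
    exact (u.isUnit.map const).mul h

/-- Scaling by the inverse of the augmentation, lifted through the constants, reduces to matrices of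
augmentation `1`. This is the input for the universal property that defines `ofLoc`. -/
theorem isUnit_of_isUnit_map_augmentation {n : ℕ} {M : Matrix (Fin n) (Fin n) (Rational A)}
    (h : IsUnit ((augmentation A).mapMatrix M)) : IsUnit M := by
  obtain ⟨u, hu⟩ := h
  have h1 : IsUnit (const.mapMatrix (u⁻¹).1 * M) :=
    LocalAugmentation.isUnit_of_map_eq_one (ε := augmentation A) (by
      change (augmentation A).mapMatrix _ = 1
      have e : (augmentation A).mapMatrix (const.mapMatrix (u⁻¹).1) = (u⁻¹).1 := by
        ext
        simp [augmentation_const]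
      rw [map_mul, ← hu, e, Units.inv_mul])
  have h2 : const.mapMatrix u.1 * (const.mapMatrix (u⁻¹).1 * M) = M := by
    rw [← mul_assoc, ← map_mul, Units.mul_inv, map_one, one_mul]
  rw [← h2]
  exact (u.isUnit.map const.mapMatrix).mul h1

end

/-! ### Comparison with the universal localization -/

open UniversalLocalization PolynomialLocalization

variable (A) in
/-- The homomorphism `A[x] → Rational A`. -/
noncomputable def ofPolynomial : Polynomial A →+* Rational A :=
  Polynomial.eval₂RingHom' const (X A) commute_const_X

theorem ofPolynomial_C (a : A) : ofPolynomial A (Polynomial.C a) = const a := by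
  simp [ofPolynomial]

theorem ofPolynomial_X : ofPolynomial A Polynomial.X = X A := by
  simp [ofPolynomial]

theorem augmentation_ofPolynomial (p : Polynomial A) :
    augmentation A (ofPolynomial A p) = Polynomial.constantCoeff p := by
  refine DFunLike.congr_fun (f := (augmentation A).comp (ofPolynomial A)) ?_ p
  refine Polynomial.ringHom_ext (fun a => ?_) ?_
  · simp [ofPolynomial_C, augmentation_const]
  · simp [ofPolynomial_X, augmentation_X]

variable (A) in
/-- The homomorphism from the universal localization. -/
noncomputable def ofLoc : PolyLoc A →+* Rational A :=
  lift _ (ofPolynomial A) fun σ => isUnit_of_isUnit_map_augmentation (by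
    convert σ.2.2
    ext
    exact augmentation_ofPolynomial _)

theorem ofLoc_incl (p : Polynomial A) : ofLoc A (incl _ p) = ofPolynomial A p := lift_incl ..

theorem augmentation_ofLoc (b : PolyLoc A) : augmentation A (ofLoc A b) = epsilon A b := by
  refine DFunLike.congr_fun (f := (augmentation A).comp (ofLoc A)) (hom_ext _ fun r => ?_) b
  rw [RingHom.comp_apply, ofLoc_incl, augmentation_ofPolynomial, aug_incl]

variable (A) in
/-- Evaluation in the universal localization. -/
noncomputable def evaluationLoc : Evaluation A (PolyLoc A) where
  coeff := (incl _).comp Polynomial.C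
  var := incl _ Polynomial.X
  comm a := by
    rw [Commute, SemiconjBy, RingHom.comp_apply, ← map_mul, ← map_mul, Polynomial.X_mul_C]
  isUnit {κ} _ _ α := by
    have h := isUnit_incl' (Polynomial.constantCoeff : Polynomial A →+* A)
      (1 - α.map fun a => Polynomial.C a * Polynomial.X) (by
        convert isUnit_one
        ext i j
        by_cases hij : i = j <;> simp [Matrix.one_apply, hij])
    convert h
    ext i j
    by_cases hij : i = j <;> simp [hij]

theorem eval_const {S : Type*} [Ring S] (E : Evaluation A S) (a : A) :
    E.eval (const a) = E.coeff a := by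
  rw [const_apply, Evaluation.eval_mk, E.value_eq (w := 1)]
  · simp
  · simp [pencil, Matrix.map_zero]

theorem eval_X {S : Type*} [Ring S] (E : Evaluation A S) : E.eval (X A) = E.var := by
  rw [X, Evaluation.eval_mk, E.value_eq (w := Matrix.fromRows (Matrix.of fun _ _ => E.var) 1)]
  · simp [Matrix.fromCols_map, Matrix.fromCols_mul_fromRows, Matrix.map_zero]
  · rw [E.pencil_fromBlocks, Matrix.fromBlocks_mul_fromRows]
    ext (_ | _) _ <;> simp [pencil]

theorem eval_ofLoc (b : PolyLoc A) : (evaluationLoc A).eval (ofLoc A b) = b := by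
  refine DFunLike.congr_fun (f := (evaluationLoc A).eval.comp (ofLoc A)) (g := RingHom.id _)
    (hom_ext _ fun r => ?_) b
  simp only [RingHom.comp_apply, ofLoc_incl, RingHom.id_apply]
  refine DFunLike.congr_fun (f := (evaluationLoc A).eval.comp (ofPolynomial A)) ?_ r
  refine Polynomial.ringHom_ext (fun a => ?_) ?_
  · simp only [RingHom.comp_apply, ofPolynomial_C, eval_const]
    rfl
  · simp only [RingHom.comp_apply, ofPolynomial_X, eval_X]
    rfl

/-- A homomorphism preserves inverses, so the resolvent of `α` in the localization goes to the
resolvent in the ring of triples; multiplying by `f` and `g` recovers the triple. -/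
theorem ofLoc_eval (b : Rational A) : ofLoc A ((evaluationLoc A).eval b) = b := by
  induction b using Rational.ind with
  | h κ f α g =>
    set P := pencil (evaluationLoc A).coeff (evaluationLoc A).var α
    have hc : ∀ {m n : Type} (M : Matrix m n A),
        (M.map (evaluationLoc A).coeff).map (ofLoc A) = M.map const := by
      intro m n M
      ext
      simp [evaluationLoc, ofLoc_incl, ofPolynomial_C]
    have hP : P.map (ofLoc A) = pencil const (X A) α := by
      have hP0 : P = 1 - α.map fun a => (evaluationLoc A).coeff a * (evaluationLoc A).var := rfl
      rw [hP0, Matrix.map_ringHom_sub, Matrix.map_ringHom_one, pencil]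
      congr 1
      ext
      simp [evaluationLoc, ofLoc_incl, ofPolynomial_C, ofPolynomial_X]
    have h1 : (Ring.inverse P).map (ofLoc A) = realize (1 : Matrix κ κ A) α (1 : Matrix κ κ A) := by
      refine left_inv_eq_right_inv (a := pencil const (X A) α) ?_ (pencil_mul_realize α)
      rw [← hP, ← Matrix.map_mul, (evaluationLoc A).inverse_mul_pencil, Matrix.map_ringHom_one]
    have h2 : ((evaluationLoc A).value f α g).map (ofLoc A) = Matrix.of fun _ _ => mk f α g := by
      rw [Evaluation.value, Matrix.map_mul, Matrix.map_mul, h1, hc, hc, mk_eq_map_const_mul]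
    exact congrFun (congrFun h2 ()) ()

end Realization

/-! ### Exact sequences and classes of endomorphisms in terms of matrices. -/

namespace EndClass

variable {A : Type*} [Ring A]

/-- A short exact sequence of pairs splits after forgetting the endomorphisms. -/
theorem ShortExact.exists_matrices {X X' X'' : Obj A} (h : ShortExact X X' X'') :
    ∃ (i : Matrix (Fin X.1) (Fin X'.1) A) (p : Matrix (Fin X'.1) (Fin X''.1) A)
      (r : Matrix (Fin X'.1) (Fin X.1) A) (j : Matrix (Fin X''.1) (Fin X'.1) A),
      LinearMap.toMatrixRight' X.2 * i = i * LinearMap.toMatrixRight' X'.2 ∧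
      LinearMap.toMatrixRight' X'.2 * p = p * LinearMap.toMatrixRight' X''.2 ∧
      i * r = 1 ∧ j * p = 1 ∧ i * p = 0 ∧ r * i + p * j = 1 := by
  obtain ⟨f, g, hf, hg, hinj, hex, hsurj⟩ := h
  have row : ∀ {m n : ℕ} {M N : Matrix (Fin m) (Fin n) A}, (∀ k, M k = N k) → M = N :=
    fun h => funext h
  have mulRow : ∀ {l m n : ℕ} (M : Matrix (Fin l) (Fin m) A) (φ : (Fin m → A) →ₗ[A] (Fin n → A)) k,
      (M * LinearMap.toMatrixRight' φ) k = φ (M k) := by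
    intro l m n M φ k
    conv_rhs => rw [← LinearMap.toMatrixRight'.symm_apply_apply φ]
    exact (Matrix.toLinearMapRight'_apply _ _).symm
  -- `j` lifts the standard basis along `g`. The rows of `1 - pj` then lie in the kernel of `g`, and
  -- their preimages under `f` give the retraction `r`.
  choose j hj using fun k => hsurj ((1 : Matrix (Fin X''.1) (Fin X''.1) A) k)
  have hjp : Matrix.of j * LinearMap.toMatrixRight' g = 1 :=
    row fun k => (mulRow _ _ k).trans (hj k)
  have hip : LinearMap.toMatrixRight' f * LinearMap.toMatrixRight' g = 0 := by
    rw [← LinearMap.toMatrixRight'_comp, hex.linearMap_comp_eq_zero, map_zero]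
  have hker : ∀ k, ∃ v, f v =
      (1 - LinearMap.toMatrixRight' g * Matrix.of j : Matrix (Fin X'.1) (Fin X'.1) A) k := by
    intro k
    refine (hex _).mp ?_
    rw [← mulRow, Matrix.sub_mul, Matrix.mul_assoc, hjp, Matrix.mul_one, Matrix.one_mul, sub_self]
    rfl
  choose r hr using hker
  have hri : Matrix.of r * LinearMap.toMatrixRight' f =
      1 - LinearMap.toMatrixRight' g * Matrix.of j := row fun k => (mulRow _ _ k).trans (hr k)
  refine ⟨LinearMap.toMatrixRight' f, LinearMap.toMatrixRight' g, Matrix.of r, Matrix.of j,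
    ?_, ?_, ?_, hjp, hip, ?_⟩
  · rw [← LinearMap.toMatrixRight'_comp, ← LinearMap.toMatrixRight'_comp]
    exact congrArg _ (LinearMap.ext hf)
  · rw [← LinearMap.toMatrixRight'_comp, ← LinearMap.toMatrixRight'_comp]
    exact congrArg _ (LinearMap.ext hg)
  · refine row fun k => hinj ?_
    rw [← mulRow, ← mulRow, Matrix.mul_assoc, hri, Matrix.mul_sub, ← Matrix.mul_assoc, hip,
      Matrix.zero_mul, sub_zero, Matrix.mul_one, Matrix.one_mul]
  · rw [hri, sub_add_cancel]

theorem cls_add_cls_of_shortExact {n n' n'' : ℕ} {α : Module.End A (Fin n → A)}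
    {α' : Module.End A (Fin n' → A)} {α'' : Module.End A (Fin n'' → A)}
    (h : ShortExact (⟨n, α⟩ : Obj A) ⟨n', α'⟩ ⟨n'', α''⟩) :
    cls n' α' = cls n α + cls n'' α'' := by
  have h1 : ((gen (⟨n, α⟩ : Obj A) + gen (⟨n'', α''⟩ : Obj A) - gen (⟨n', α'⟩ : Obj A) :
      FreeAbelianGroup (IsoClass A)) : Group A) = 0 :=
    (QuotientAddGroup.eq_zero_iff _).mpr (AddSubgroup.subset_closure (Or.inl ⟨_, _, _, h, rfl⟩))
  exact (sub_eq_zero.mp h1).symm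

theorem cls_one_zero : cls 1 (0 : Module.End A (Fin 1 → A)) = 0 :=
  (QuotientAddGroup.eq_zero_iff _).mpr (AddSubgroup.subset_closure (Or.inr rfl))

theorem cls_exact {n n' n'' : ℕ} {α : Matrix (Fin n) (Fin n) A} {α' : Matrix (Fin n') (Fin n') A}
    {α'' : Matrix (Fin n'') (Fin n'') A} (i : Matrix (Fin n) (Fin n') A)
    (p : Matrix (Fin n') (Fin n'') A) (r : Matrix (Fin n') (Fin n) A)
    (j : Matrix (Fin n'') (Fin n') A) (hi : α * i = i * α') (hp : α' * p = p * α'')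
    (hir : i * r = 1) (hjp : j * p = 1) (hip : i * p = 0) (h1 : r * i + p * j = 1) :
    cls n' α'.toLinearMapRight' = cls n α.toLinearMapRight' + cls n'' α''.toLinearMapRight' := by
  refine cls_add_cls_of_shortExact ⟨i.toLinearMapRight', p.toLinearMapRight', ?_, ?_, ?_, ?_, ?_⟩
  · intro v
    simp only [Matrix.toLinearMapRight'_apply, Matrix.vecMul_vecMul, hi]
  · intro v
    simp only [Matrix.toLinearMapRight'_apply, Matrix.vecMul_vecMul, hp]
  · refine Function.LeftInverse.injective (g := r.toLinearMapRight') fun v => ?_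
    simp only [Matrix.toLinearMapRight'_apply, Matrix.vecMul_vecMul, hir, Matrix.vecMul_one]
  · intro v
    constructor
    · intro hv
      refine ⟨Matrix.vecMul v r, ?_⟩
      simp only [Matrix.toLinearMapRight'_apply] at hv ⊢
      rw [Matrix.vecMul_vecMul, eq_sub_of_add_eq h1, Matrix.vecMul_sub, ← Matrix.vecMul_vecMul, hv]
      simp
    · rintro ⟨w, rfl⟩
      simp only [Matrix.toLinearMapRight'_apply, Matrix.vecMul_vecMul, hip, Matrix.vecMul_zero]
  · refine Function.RightInverse.surjective (g := j.toLinearMapRight') fun v => ?_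
    simp only [Matrix.toLinearMapRight'_apply, Matrix.vecMul_vecMul, hjp, Matrix.vecMul_one]

/-- The class of a square matrix over `A`. -/
noncomputable def matCls {κ : Type} [Fintype κ] [DecidableEq κ] (α : Matrix κ κ A) : Group A :=
  cls (Fintype.card κ)
    (α.submatrix (Fintype.equivFin κ).symm (Fintype.equivFin κ).symm).toLinearMapRight'

section

variable {κ l m : Type} [Fintype κ] [DecidableEq κ] [Fintype l] [DecidableEq l] [Fintype m]
  [DecidableEq m]

theorem matCls_exact {α : Matrix κ κ A} {α' : Matrix l l A} {α'' : Matrix m m A}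
    (i : Matrix κ l A) (p : Matrix l m A) (r : Matrix l κ A) (j : Matrix m l A)
    (hi : α * i = i * α') (hp : α' * p = p * α'') (hir : i * r = 1) (hjp : j * p = 1)
    (hip : i * p = 0) (h1 : r * i + p * j = 1) : matCls α' = matCls α + matCls α'' := by
  refine cls_exact (i.submatrix (Fintype.equivFin κ).symm (Fintype.equivFin l).symm)
    (p.submatrix (Fintype.equivFin l).symm (Fintype.equivFin m).symm)
    (r.submatrix (Fintype.equivFin l).symm (Fintype.equivFin κ).symm)
    (j.submatrix (Fintype.equivFin m).symm (Fintype.equivFin l).symm) ?_ ?_ ?_ ?_ ?_ ?_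
  · rw [Matrix.submatrix_mul_equiv, Matrix.submatrix_mul_equiv, hi]
  · rw [Matrix.submatrix_mul_equiv, Matrix.submatrix_mul_equiv, hp]
  · rw [Matrix.submatrix_mul_equiv, hir, Matrix.submatrix_one_equiv]
  · rw [Matrix.submatrix_mul_equiv, hjp, Matrix.submatrix_one_equiv]
  · rw [Matrix.submatrix_mul_equiv, hip, Matrix.submatrix_zero]
    rfl
  · rw [Matrix.submatrix_mul_equiv, Matrix.submatrix_mul_equiv, ← Matrix.submatrix_one_equiv
      (Fintype.equivFin l).symm, ← h1]
    rfl

/-- The exact sequence with all three terms equal to `A⁰` gives `[A⁰] = [A⁰] + [A⁰]`. -/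
theorem cls_fin_zero (α : Matrix (Fin 0) (Fin 0) A) : cls 0 α.toLinearMapRight' = 0 := by
  have h := cls_exact (α := α) (α' := α) (α'' := α) 0 0 0 0 (Subsingleton.elim _ _)
    (Subsingleton.elim _ _) (Subsingleton.elim _ _) (Subsingleton.elim _ _)
    (Subsingleton.elim _ _) (Subsingleton.elim _ _)
  exact left_eq_add.mp h

/-- The enumeration of `Fin n` chosen by `Fintype.equivFin` need not be the identity, so this is
conjugation by a permutation matrix, phrased as an exact sequence with last term `A⁰`. -/
theorem matCls_fin {n : ℕ} (α : Matrix (Fin n) (Fin n) A) :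
    matCls α = cls n α.toLinearMapRight' := by
  have h := cls_exact (α := α)
    (α' := α.submatrix (Fintype.equivFin (Fin n)).symm (Fintype.equivFin (Fin n)).symm)
    (α'' := (0 : Matrix (Fin 0) (Fin 0) A))
    ((1 : Matrix (Fin n) (Fin n) A).submatrix id (Fintype.equivFin (Fin n)).symm) 0
    ((1 : Matrix (Fin n) (Fin n) A).submatrix (Fintype.equivFin (Fin n)).symm id) 0
    (by
      have h1 := Matrix.submatrix_mul_equiv α (1 : Matrix (Fin n) (Fin n) A) id (Equiv.refl _)
        (Fintype.equivFin (Fin n)).symm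
      have h2 := Matrix.submatrix_mul_equiv (1 : Matrix (Fin n) (Fin n) A) α id
        (Fintype.equivFin (Fin n)).symm (Fintype.equivFin (Fin n)).symm
      rw [h2, Matrix.one_mul]
      exact h1.trans (by rw [Matrix.mul_one]))
    (Subsingleton.elim _ _)
    (by rw [Matrix.submatrix_mul_equiv, Matrix.one_mul, Matrix.submatrix_id_id])
    (Subsingleton.elim _ _) (Subsingleton.elim _ _)
    (by
      have h1 := Matrix.submatrix_mul_equiv (1 : Matrix (Fin n) (Fin n) A) 1
        (Fintype.equivFin (Fin n)).symm (Equiv.refl _) (Fintype.equivFin (Fin n)).symm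
      rw [Matrix.zero_mul, add_zero]
      exact h1.trans (by rw [Matrix.one_mul, Matrix.submatrix_one_equiv]))
  rw [cls_fin_zero, add_zero] at h
  exact h

theorem matCls_empty (α : Matrix Empty Empty A) : matCls α = 0 := by
  have h := matCls_exact (α := α) (α' := α) (α'' := α) 0 0 0 0 (Subsingleton.elim _ _)
    (Subsingleton.elim _ _) (Subsingleton.elim _ _) (Subsingleton.elim _ _)
    (Subsingleton.elim _ _) (Subsingleton.elim _ _)
  exact left_eq_add.mp h

theorem matCls_conj {α : Matrix κ κ A} {β : Matrix l l A} (P : Matrix κ l A) (Q : Matrix l κ A)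
    (hPQ : P * Q = 1) (hQP : Q * P = 1) (h : α * P = P * β) : matCls α = matCls β := by
  have := matCls_exact (α'' := (0 : Matrix Empty Empty A)) P 0 Q 0 h (Subsingleton.elim _ _) hPQ
    (Subsingleton.elim _ _) (Subsingleton.elim _ _) (by rw [Matrix.zero_mul, add_zero, hQP])
  rw [this, matCls_empty, add_zero]

theorem matCls_submatrix (e : l ≃ κ) (α : Matrix κ κ A) : matCls (α.submatrix e e) = matCls α := by
  refine matCls_conj ((1 : Matrix κ κ A).submatrix e id) ((1 : Matrix κ κ A).submatrix id e)
    ?_ ?_ ?_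
  · exact (Matrix.submatrix_mul_equiv (1 : Matrix κ κ A) 1 e (Equiv.refl _) e).trans
      (by rw [Matrix.one_mul, Matrix.submatrix_one_equiv])
  · rw [Matrix.submatrix_mul_equiv, Matrix.one_mul, Matrix.submatrix_id_id]
  · rw [Matrix.submatrix_mul_equiv, Matrix.mul_one]
    have := Matrix.submatrix_mul_equiv (1 : Matrix κ κ A) α e (Equiv.refl _) id
    rw [Matrix.one_mul] at this
    exact this.symm

/-- Matrices act on row vectors from the right, so the invariant submodule is the second summand and
the quotient is the first. -/
theorem matCls_fromBlocks_zero₂₁ (α : Matrix κ κ A) (β : Matrix κ l A) (δ : Matrix l l A) :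
    matCls (Matrix.fromBlocks α β 0 δ) = matCls α + matCls δ := by
  rw [add_comm]
  refine matCls_exact (Matrix.fromCols 0 1) (Matrix.fromRows 1 0) (Matrix.fromRows 0 1)
    (Matrix.fromCols 1 0) ?_ ?_ ?_ ?_ ?_ ?_
  · simp [Matrix.fromCols_mul_fromBlocks, Matrix.mul_fromCols]
  · simp [Matrix.fromBlocks_mul_fromRows, Matrix.fromRows_mul]
  · simp [Matrix.fromCols_mul_fromRows]
  · simp [Matrix.fromCols_mul_fromRows]
  · simp [Matrix.fromCols_mul_fromRows]
  · rw [Matrix.fromRows_mul_fromCols, Matrix.fromRows_mul_fromCols, Matrix.fromBlocks_add]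
    simp

theorem matCls_fromBlocks_zero₁₂ (α : Matrix κ κ A) (γ : Matrix l κ A) (δ : Matrix l l A) :
    matCls (Matrix.fromBlocks α 0 γ δ) = matCls α + matCls δ := by
  refine matCls_exact (Matrix.fromCols 1 0) (Matrix.fromRows 0 1) (Matrix.fromRows 1 0)
    (Matrix.fromCols 0 1) ?_ ?_ ?_ ?_ ?_ ?_
  · simp [Matrix.fromCols_mul_fromBlocks, Matrix.mul_fromCols]
  · simp [Matrix.fromBlocks_mul_fromRows, Matrix.fromRows_mul]
  · simp [Matrix.fromCols_mul_fromRows]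
  · simp [Matrix.fromCols_mul_fromRows]
  · simp [Matrix.fromCols_mul_fromRows]
  · rw [Matrix.fromRows_mul_fromCols, Matrix.fromRows_mul_fromCols, Matrix.fromBlocks_add]
    simp

theorem matCls_unit_zero : matCls (0 : Matrix Unit Unit A) = 0 := by
  rw [← matCls_submatrix (Equiv.ofUnique (Fin 1) Unit), matCls_fin, ← cls_one_zero,
    ← map_zero Matrix.toLinearMapRight']
  rfl

variable (κ A) in
theorem matCls_zero : matCls (0 : Matrix κ κ A) = 0 := by
  have h : ∀ n : ℕ, matCls (0 : Matrix (Fin n) (Fin n) A) = 0 := by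
    intro n
    induction n with
    | zero => rw [matCls_fin, cls_fin_zero]
    | succ n ih =>
      rw [← matCls_submatrix (LocalAugmentation.blockIndex n)]
      have : (0 : Matrix (Fin (n + 1)) (Fin (n + 1)) A).submatrix (LocalAugmentation.blockIndex n)
          (LocalAugmentation.blockIndex n) = Matrix.fromBlocks 0 0 0 0 := by
        rw [Matrix.fromBlocks_zero]
        rfl
      rw [this, matCls_fromBlocks_zero₂₁, ih, matCls_unit_zero, add_zero]
  rw [← matCls_submatrix (Fintype.equivFin κ).symm]
  exact h _

/-! ### The map to the reduced endomorphism class group -/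

/-- The class `[(1 - gf)α] - [α]` of a realization. -/
noncomputable def tripleClass (f : Matrix Unit κ A) (α : Matrix κ κ A) (g : Matrix κ Unit A) :
    Group A := matCls (α - g * (f * α)) - matCls α

/-- After clearing differences, the claim is `[α - gfα] + [α'] = [α] + [α' - g'f'α']`. Both sides
are classes of block triangular matrices with the same lower left block `g'fα`, and these are
conjugate by the unipotent matrix with entry `-φ`. -/
theorem tripleClass_congr {f : Matrix Unit κ A} {α : Matrix κ κ A} {g : Matrix κ Unit A}
    {f' : Matrix Unit l A} {α' : Matrix l l A} {g' : Matrix l Unit A} (φ : Matrix κ l A)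
    (h : α * φ = φ * α') (hf : f * φ = f') (hg : g = φ * g') :
    tripleClass f α g = tripleClass f' α' g' := by
  subst hf hg
  have h1 := matCls_fromBlocks_zero₁₂ (α - φ * g' * (f * α)) (g' * (f * α)) α'
  have h2 := matCls_fromBlocks_zero₁₂ α (g' * (f * α)) (α' - g' * (f * φ * α'))
  have h3 : matCls (Matrix.fromBlocks (α - φ * g' * (f * α)) 0 (g' * (f * α)) α') =
      matCls (Matrix.fromBlocks α 0 (g' * (f * α)) (α' - g' * (f * φ * α'))) := by
    refine matCls_conj (Matrix.fromBlocks 1 (-φ) 0 1) (Matrix.fromBlocks 1 φ 0 1) ?_ ?_ ?_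
    · rw [Matrix.fromBlocks_multiply, ← Matrix.fromBlocks_one]
      simp
    · rw [Matrix.fromBlocks_multiply, ← Matrix.fromBlocks_one]
      simp
    · rw [Matrix.fromBlocks_multiply, Matrix.fromBlocks_multiply]
      simp [Matrix.mul_assoc, h, Matrix.add_mul, Matrix.mul_add, sub_eq_add_neg, add_comm]
  rw [h1, h2] at h3
  rw [tripleClass, tripleClass, sub_eq_sub_iff_add_eq_add, h3, add_comm]

open Realization

/-- The class of an element of `Rational A`. -/
noncomputable def rationalClass (b : Rational A) : Group A :=
  Quot.lift (fun X : Realization A => tripleClass X.row X.mat X.col)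
    (fun _ _ ⟨φ, h, hf, hg⟩ => tripleClass_congr φ h hf hg) b

theorem rationalClass_mk (f : Matrix Unit κ A) (α : Matrix κ κ A) (g : Matrix κ Unit A) :
    rationalClass (mk f α g) = tripleClass f α g := rfl

/-- The conditions `f g = 1` and `f' g' = 1` make the upper right block cancel, so the corrected
matrix of the product is lower triangular with diagonal blocks `α - gfα` and `α' - g'f'α'`. -/
theorem tripleClass_mul {f : Matrix Unit κ A} (α : Matrix κ κ A) {g : Matrix κ Unit A}
    (f' : Matrix Unit l A) (α' : Matrix l l A) {g' : Matrix l Unit A} (h : f * g = 1)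
    (h' : f' * g' = 1) :
    tripleClass (Matrix.fromCols f 0) (Matrix.fromBlocks α (g * f' * α') 0 α')
      (Matrix.fromRows (g * f' * g') g') = tripleClass f α g + tripleClass f' α' g' := by
  have e : Matrix.fromBlocks α (g * f' * α') 0 α' - Matrix.fromRows (g * f' * g') g' *
      (Matrix.fromCols f (0 : Matrix Unit l A) * Matrix.fromBlocks α (g * f' * α') 0 α') =
      Matrix.fromBlocks (α - g * (f * α)) 0 (-(g' * (f * α))) (α' - g' * (f' * α')) := by
    have e1 : f * (g * f' * α') = f' * α' := by
      rw [← Matrix.mul_assoc, ← Matrix.mul_assoc, h, Matrix.one_mul]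
    have e2 : g * f' * g' = g := by rw [Matrix.mul_assoc, h', Matrix.mul_one]
    rw [Matrix.fromCols_mul_fromBlocks, e1, e2, Matrix.fromRows_mul_fromCols, sub_eq_add_neg,
      Matrix.fromBlocks_neg, Matrix.fromBlocks_add]
    simp [sub_eq_add_neg, Matrix.mul_assoc]
  rw [tripleClass, e, matCls_fromBlocks_zero₁₂, matCls_fromBlocks_zero₂₁, tripleClass, tripleClass]
  abel

theorem rationalClass_mul {a b : Rational A} (ha : augmentation A a = 1)
    (hb : augmentation A b = 1) :
    rationalClass (a * b) = rationalClass a + rationalClass b := by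
  induction a using Rational.ind
  induction b using Rational.ind
  rw [augmentation_mk] at ha hb
  exact tripleClass_mul _ _ _ (by ext; simpa using ha) (by ext; simpa using hb)

/-- The left side is the class of the standard realization of `1 + ab`. The hypothesis, which
expresses `ε(ba) = 0`, removes the quadratic correction from the upper right block. What remains is
symmetric in the two triples up to reordering the blocks and changing the off-diagonal signs. -/
theorem tripleClass_one_add_mul (f : Matrix Unit κ A) (α : Matrix κ κ A) (g : Matrix κ Unit A)
    (f' : Matrix Unit l A) (α' : Matrix l l A) (g' : Matrix l Unit A)
    (h : f' * g' * (f * g) = 0) :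
    tripleClass (Matrix.fromCols (1 : Matrix Unit Unit A) (Matrix.fromCols f 0))
      (Matrix.fromBlocks 0 0 0 (Matrix.fromBlocks α (g * f' * α') 0 α'))
      (Matrix.fromRows 1 (Matrix.fromRows (g * f' * g') g')) =
    matCls (Matrix.fromBlocks (α - g * (f' * (g' * (f * α)))) (g * (f' * α'))
      (-(g' * (f * α))) (α' - g' * (f * (g * (f' * α'))))) - (matCls α + matCls α') := by
  have e : ∀ (M : Matrix (κ ⊕ l) (κ ⊕ l) A) (F : Matrix Unit (κ ⊕ l) A)
      (G : Matrix (κ ⊕ l) Unit A),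
      Matrix.fromBlocks (0 : Matrix Unit Unit A) 0 0 M -
        Matrix.fromRows (1 : Matrix Unit Unit A) G * (Matrix.fromCols (1 : Matrix Unit Unit A) F *
          Matrix.fromBlocks (0 : Matrix Unit Unit A) 0 0 M) =
      Matrix.fromBlocks 0 (-(F * M)) 0 (M - G * (F * M)) := by
    intro M F G
    rw [Matrix.fromCols_mul_fromBlocks, Matrix.fromRows_mul_fromCols, sub_eq_add_neg,
      Matrix.fromBlocks_neg, Matrix.fromBlocks_add]
    simp [sub_eq_add_neg]
  have e0 : g * (f' * (g' * (f * (g * (f' * α'))))) = 0 := by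
    have : g * (f' * (g' * (f * (g * (f' * α'))))) = g * ((f' * g' * (f * g)) * (f' * α')) := by
      simp only [Matrix.mul_assoc]
    rw [this, h, Matrix.zero_mul, Matrix.mul_zero]
  have e' : Matrix.fromBlocks α (g * f' * α') 0 α' - Matrix.fromRows (g * f' * g') g' *
      (Matrix.fromCols f (0 : Matrix Unit l A) * Matrix.fromBlocks α (g * f' * α') 0 α') =
      Matrix.fromBlocks (α - g * (f' * (g' * (f * α)))) (g * (f' * α'))
      (-(g' * (f * α))) (α' - g' * (f * (g * (f' * α')))) := by
    rw [Matrix.fromCols_mul_fromBlocks, Matrix.fromRows_mul_fromCols, sub_eq_add_neg,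
      Matrix.fromBlocks_neg, Matrix.fromBlocks_add]
    simp [sub_eq_add_neg, Matrix.mul_assoc, e0]
  rw [tripleClass, e, e', matCls_fromBlocks_zero₂₁, matCls_fromBlocks_zero₂₁,
    matCls_fromBlocks_zero₂₁, matCls_zero, zero_add, zero_add]

theorem rationalClass_one_add_mul_comm {a b : Rational A} (hab : augmentation A (a * b) = 0)
    (hba : augmentation A (b * a) = 0) :
    rationalClass (1 + a * b) = rationalClass (1 + b * a) := by
  induction a using Rational.ind with
  | h κ f α g =>
  induction b using Rational.ind with
  | h l f' α' g' =>
  rw [map_mul, augmentation_mk, augmentation_mk] at hab hba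
  have hab' : f * g * (f' * g') = 0 := by
    ext
    rw [Matrix.mul_apply]
    simpa using hab
  have hba' : f' * g' * (f * g) = 0 := by
    ext
    rw [Matrix.mul_apply]
    simpa using hba
  refine (tripleClass_one_add_mul f α g f' α' g' hba').trans
    (Eq.trans ?_ (tripleClass_one_add_mul f' α' g' f α g hab').symm)
  rw [add_comm (matCls α)]
  congr 1
  -- The signed permutation interchanges the diagonal blocks and interchanges the off-diagonal ones
  -- with a change of sign.
  refine matCls_conj (Matrix.fromBlocks 0 1 (-1) 0) (Matrix.fromBlocks 0 (-1) 1 0) ?_ ?_ ?_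
  · rw [Matrix.fromBlocks_multiply, ← Matrix.fromBlocks_one]
    simp
  · rw [Matrix.fromBlocks_multiply, ← Matrix.fromBlocks_one]
    simp
  · rw [Matrix.fromBlocks_multiply, Matrix.fromBlocks_multiply]
    simp

/-- The classes of the elements of augmentation `1` exhaust the group. -/
theorem matCls_mem_of_rationalClass_mem (R : AddSubgroup (Group A))
    (hR : ∀ b : Rational A, augmentation A b = 1 → rationalClass b ∈ R) (α : Matrix κ κ A) :
    matCls α ∈ R := by
  -- Induction on a set of rows outside of which the matrix vanishes.
  suffices h : ∀ (s : Finset κ) (α : Matrix κ κ A), (∀ i ∉ s, α i = 0) → matCls α ∈ R from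
    h Finset.univ α fun i hi => absurd (Finset.mem_univ i) hi
  intro s
  induction s using Finset.induction_on with
  | empty =>
    intro α hα
    have : α = 0 := funext fun i => hα i (Finset.notMem_empty i)
    rw [this, matCls_zero]
    exact zero_mem R
  | insert a s _ ih =>
    intro α hα
    -- With `f` and `g` the basis row and column at `a`, `gfα` is row `a` of `α` left in place, so
    -- `α - gfα` is `α` with that row cleared.
    set f : Matrix Unit κ A := (1 : Matrix κ κ A).submatrix (fun _ => a) id with hf
    set g : Matrix κ Unit A := (1 : Matrix κ κ A).submatrix id fun _ => a with hg
    have h1 : f * g = 1 := by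
      ext
      simp [hf, hg, Matrix.mul_apply, Matrix.one_apply]
    have h2 := hR (mk f α g) (by rw [augmentation_mk, h1, Matrix.one_apply_eq])
    rw [rationalClass_mk, tripleClass] at h2
    have h3 : matCls (α - g * (f * α)) ∈ R := by
      refine ih _ fun i hi => ?_
      have h4 : (g * (f * α)) i = if i = a then α a else 0 := by
        funext j
        by_cases hia : i = a <;>
        simp [hf, hg, Matrix.mul_apply, Matrix.one_apply, hia]
      change α i - (g * (f * α)) i = 0
      rw [h4]
      split_ifs with hia
      · rw [hia, sub_self]
      · rw [hα i (by simp [hia, hi]), sub_zero]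
    have := sub_mem h3 h2
    rwa [sub_sub_cancel] at this

theorem mem_of_forall_cls_mem {R : AddSubgroup (Group A)}
    (h : ∀ n (α : Module.End A (Fin n → A)), cls n α ∈ R) (z : Group A) : z ∈ R := by
  obtain ⟨z, rfl⟩ := QuotientAddGroup.mk_surjective z
  induction z using FreeAbelianGroup.induction_on with
  | zero => exact zero_mem R
  | of x =>
    obtain ⟨⟨n, α⟩, rfl⟩ := Quotient.exists_rep x
    exact h n α
  | neg x hx => exact neg_mem hx
  | add x y hx hy => exact add_mem hx hy

end

end EndClass

/-! ### The homomorphisms in both directions and their comparison. -/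

namespace PolynomialLocalization

open Realization UniversalLocalization LocalAugmentation
open EndClass hiding Group

variable {A : Type*} [Ring A]

theorem epsilon_var : epsilon A (evaluationLoc A).var = 0 := by
  simp [evaluationLoc]

theorem map_mapVar {m n : Type} (M : Matrix m n A) :
    (M.map fun a => (evaluationLoc A).coeff a * (evaluationLoc A).var).map (epsilon A) = 0 := by
  ext
  simp [epsilon_var]

theorem map_pencil {κ : Type} [DecidableEq κ] (α : Matrix κ κ A) :
    (pencil (evaluationLoc A).coeff (evaluationLoc A).var α).map (epsilon A) = 1 := by
  rw [pencil, Matrix.map_ringHom_sub, map_mapVar, Matrix.map_ringHom_one, sub_zero]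

/-- The class of `D(1 - αx)`. -/
noncomputable def charDet {n : ℕ} (α : Matrix (Fin n) (Fin n) A) :
    OneFiber (epsilon A) ⧸ C (epsilon A) :=
  det (epsilon A) (pencil (evaluationLoc A).coeff (evaluationLoc A).var α)

theorem charDet_eq {n : ℕ} (α : Module.End A (Fin n → A)) :
    charDet (LinearMap.toMatrixRight' α) =
      D (epsilon A) n (oneSubMulX α) (map_oneSubMulX α) := by
  rw [← det_eq, charDet]
  congr 1
  ext i j
  by_cases hij : i = j <;> simp [pencil, oneSubMulX, evaluationLoc, hij]

/-- Attaching `x` to `Q` yields a factor killed by `ε`, as the swap identity requires, while `P`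
remains constant. -/
theorem charDet_mul_comm {n m : ℕ} (P : Matrix (Fin n) (Fin m) A) (Q : Matrix (Fin m) (Fin n) A) :
    charDet (P * Q) = charDet (Q * P) := by
  have h := det_one_add_mul_comm (ε := epsilon A) (P.map (evaluationLoc A).coeff)
    (-(Q.map fun a => (evaluationLoc A).coeff a * (evaluationLoc A).var))
    (by rw [Matrix.map_ringHom_neg, map_mapVar, neg_zero])
  rwa [Matrix.mul_neg, Matrix.neg_mul, map_mul_mapVar, mapVar_mul_map _ _ (evaluationLoc A).comm,
    ← sub_eq_add_neg, ← sub_eq_add_neg] at h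

/-- The cross term in `(1 - Mx)(1 - Nx)` is `MNx² = 0`. -/
theorem charDet_add {n : ℕ} {M N : Matrix (Fin n) (Fin n) A} (h : M * N = 0) :
    charDet (M + N) = charDet M * charDet N := by
  rw [charDet, charDet, charDet, ← det_mul (map_pencil M) (map_pencil N)]
  congr 1
  have h1 : (M.map fun a => (evaluationLoc A).coeff a * (evaluationLoc A).var) *
      (N.map fun a => (evaluationLoc A).coeff a * (evaluationLoc A).var) = 0 := by
    have h2 := mapVar_mul_map _ _ (evaluationLoc A).comm M N
    rw [h] at h2
    ext i j
    have h3 := congrFun (congrFun h2 i) j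
    simp only [Matrix.mul_apply, Matrix.map_apply, Matrix.zero_apply, map_zero, zero_mul] at h3 ⊢
    simp only [← mul_assoc]
    rw [← Finset.sum_mul, h3, zero_mul]
  simp only [pencil, Matrix.sub_mul, Matrix.mul_sub, h1, Matrix.one_mul, Matrix.mul_one]
  ext i j
  simp [add_mul]
  abel

/-- The splitting `ri + pj = 1` gives `α' = rαi + pjα'`, and the product of the summands vanishes
because `ip = 0`. Swapping the factors, `rαi` becomes `αir = α`, and `pjα'` becomes `jα'p = jpα'' =
α''`. -/
theorem charDet_exact {n n' n'' : ℕ} {α : Matrix (Fin n) (Fin n) A}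
    {α' : Matrix (Fin n') (Fin n') A} {α'' : Matrix (Fin n'') (Fin n'') A}
    (i : Matrix (Fin n) (Fin n') A) (p : Matrix (Fin n') (Fin n'') A)
    (r : Matrix (Fin n') (Fin n) A) (j : Matrix (Fin n'') (Fin n') A) (hi : α * i = i * α')
    (hp : α' * p = p * α'') (hir : i * r = 1) (hjp : j * p = 1) (hip : i * p = 0)
    (h1 : r * i + p * j = 1) : charDet α' = charDet α * charDet α'' := by
  have e : α' = r * (α * i) + p * (j * α') := by
    rw [hi, ← Matrix.mul_assoc, ← Matrix.mul_assoc, ← Matrix.add_mul, h1, Matrix.one_mul]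
  have e0 : r * (α * i) * (p * (j * α')) = 0 := by
    have : r * (α * i) * (p * (j * α')) = r * α * (i * p) * (j * α') := by
      simp only [Matrix.mul_assoc]
    rw [this, hip, Matrix.mul_zero, Matrix.zero_mul]
  rw [e, charDet_add e0, charDet_mul_comm, charDet_mul_comm p, Matrix.mul_assoc, hir,
    Matrix.mul_one, Matrix.mul_assoc, hp, ← Matrix.mul_assoc, hjp, Matrix.one_mul]

theorem charDet_eq_one {α : Matrix (Fin 1) (Fin 1) A} (h : α = 0) : charDet α = 1 := by
  have : pencil (evaluationLoc A).coeff (evaluationLoc A).var α = 1 := by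
    rw [h]
    ext
    simp [pencil]
  rw [charDet, this, det_one]

theorem charDet_eq_of_equiv {X Y : Obj A} (h : X ≈ Y) :
    charDet (LinearMap.toMatrixRight' X.2) = charDet (LinearMap.toMatrixRight' Y.2) := by
  obtain ⟨e, he⟩ := h
  -- An isomorphism is a short exact sequence with last term `A⁰`, where the determinant is `1`.
  have hs : ShortExact X Y (⟨0, 0⟩ : Obj A) :=
    ⟨e.toLinearMap, 0, he, fun _ => Subsingleton.elim _ _, e.injective,
      fun v => ⟨fun _ => e.surjective v, fun _ => Subsingleton.elim _ _⟩,
      fun _ => ⟨0, Subsingleton.elim _ _⟩⟩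
  obtain ⟨i, p, r, j, hi, hp, hir, hjp, hip, h1⟩ := hs.exists_matrices
  rw [charDet_exact i p r j hi hp hir hjp hip h1, charDet.eq_def (n := 0), det_zero, mul_one]

variable (A) in
/-- The characteristic determinant on isomorphism classes. -/
noncomputable def isoClassDet (x : IsoClass A) :
    Additive (OneFiber (epsilon A) ⧸ C (epsilon A)) :=
  Quotient.lift (fun X : Obj A => Additive.ofMul (charDet (LinearMap.toMatrixRight' X.2)))
    (fun _ _ h => congrArg Additive.ofMul (charDet_eq_of_equiv h)) x

variable (A) in
/-- The homomorphism `[Aⁿ, α] ↦ D(1 - αx)`. -/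
noncomputable def charHom : EndClass.Group A →+ Additive (OneFiber (epsilon A) ⧸ C (epsilon A)) :=
  QuotientAddGroup.lift _ (FreeAbelianGroup.lift (isoClassDet A)) (by
    rw [AddSubgroup.closure_le]
    have hgen : ∀ X : Obj A, FreeAbelianGroup.lift (isoClassDet A) (gen X) =
        Additive.ofMul (charDet (LinearMap.toMatrixRight' X.2)) := fun X =>
      FreeAbelianGroup.lift_apply_of _ _
    rintro z (⟨X, X', X'', hs, rfl⟩ | rfl)
    · obtain ⟨i, p, r, j, hi, hp, hir, hjp, hip, h1⟩ := hs.exists_matrices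
      have h := charDet_exact i p r j hi hp hir hjp hip h1
      change FreeAbelianGroup.lift (isoClassDet A) _ = 0
      rw [map_sub, map_add, hgen, hgen, hgen, h, ofMul_mul, sub_self]
    · change FreeAbelianGroup.lift (isoClassDet A) _ = 0
      rw [hgen]
      exact congrArg Additive.ofMul (charDet_eq_one (map_zero _)))

theorem charHom_cls {n : ℕ} (α : Module.End A (Fin n → A)) :
    charHom A (cls n α) = Additive.ofMul (charDet (LinearMap.toMatrixRight' α)) :=
  FreeAbelianGroup.lift_apply_of _ _

theorem charHom_matCls {n : ℕ} (α : Matrix (Fin n) (Fin n) A) :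
    charHom A (matCls α) = Additive.ofMul (charDet α) := by
  rw [matCls_fin, charHom_cls, LinearEquiv.apply_symm_apply]

/-- With `s = (1 - αx)⁻¹` and `U = fαxs`, one has `1 - (α - gfα)x = (1 + gU)(1 - αx)`, and swapping
turns `1 + gU` into `1 + Ug`, which equals `f s g` since `f g = 1`. -/
theorem charDet_sub {n : ℕ} {f : Matrix Unit (Fin n) A} {α : Matrix (Fin n) (Fin n) A}
    {g : Matrix (Fin n) Unit A} (h : f * g = 1) :
    charDet (α - g * (f * α)) =
      elemClass (epsilon A) ((evaluationLoc A).eval (mk f α g)) * charDet α := by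
  set E := evaluationLoc A with hE
  set s := Ring.inverse (pencil E.coeff E.var α) with hs
  set U := ((f * α).map fun a => E.coeff a * E.var) * s with hU
  have hs1 : s = 1 + (α.map fun a => E.coeff a * E.var) * s := by
    have := E.pencil_mul_inverse α
    rw [← hs, pencil, Matrix.sub_mul, Matrix.one_mul, sub_eq_iff_eq_add] at this
    exact this
  have h1 : E.value f α g = 1 + U * g.map E.coeff := by
    rw [Evaluation.value, ← hs, ← Matrix.mul_assoc]
    nth_rewrite 1 [hs1]
    rw [Matrix.mul_add, Matrix.mul_one, ← Matrix.mul_assoc, map_mul_mapVar, Matrix.add_mul,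
      ← Matrix.map_mul, h, Matrix.map_ringHom_one]
  have h2 : pencil E.coeff E.var (α - g * (f * α)) =
      (1 + g.map E.coeff * U) * pencil E.coeff E.var α := by
    rw [Matrix.add_mul, Matrix.one_mul, hU, Matrix.mul_assoc, Matrix.mul_assoc,
      E.inverse_mul_pencil, Matrix.mul_one, map_mul_mapVar]
    rw [pencil, mapVar_sub, ← sub_add, ← pencil]
  have hUε : U.map (epsilon A) = 0 := by
    rw [hU, Matrix.map_mul, map_mapVar, Matrix.zero_mul]
  rw [charDet, h2, det_mul, det_one_add_col_mul_row _ _ hUε, ← h1]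
  · rfl
  · rw [Matrix.map_ringHom_add, Matrix.map_mul, hUε, Matrix.mul_zero, add_zero,
      Matrix.map_ringHom_one]
  · exact map_pencil α

/-- Every element of `Rational A` has a realization indexed by some `Fin n`. -/
theorem exists_mk_fin (b : Rational A) :
    ∃ (n : ℕ) (f : Matrix Unit (Fin n) A) (α : Matrix (Fin n) (Fin n) A)
      (g : Matrix (Fin n) Unit A), mk f α g = b := by
  induction b using Rational.ind with
  | h κ f α g =>
    let e := (Fintype.equivFin κ).symm
    refine ⟨Fintype.card κ, f.submatrix id e, α.submatrix e e, g.submatrix e id,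
      mk_eq ((1 : Matrix κ κ A).submatrix e id) ?_ ?_ ?_⟩
    · rw [Matrix.submatrix_mul_equiv, Matrix.mul_one]
      have := Matrix.submatrix_mul_equiv (1 : Matrix κ κ A) α e (Equiv.refl _) id
      rw [Matrix.one_mul] at this
      exact this.symm
    · rw [Matrix.submatrix_mul_equiv, Matrix.mul_one, Matrix.submatrix_id_id]
    · have := Matrix.submatrix_mul_equiv (1 : Matrix κ κ A) g e (Equiv.refl _) id
      rw [Matrix.one_mul] at this
      exact this.symm

theorem charHom_rationalClass {b : PolyLoc A} (hb : epsilon A b = 1) :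
    charHom A (rationalClass (ofLoc A b)) = Additive.ofMul (elemClass (epsilon A) b) := by
  obtain ⟨n, f, α, g, h⟩ := exists_mk_fin (ofLoc A b)
  have h1 : f * g = 1 := by
    rw [← augmentation_ofLoc, ← h, augmentation_mk] at hb
    ext
    simpa using hb
  have h2 : (evaluationLoc A).eval (mk f α g) = b := by rw [h, eval_ofLoc]
  rw [← h, rationalClass_mk, tripleClass, map_sub, charHom_matCls, charHom_matCls, charDet_sub h1,
    h2, ofMul_mul, add_sub_cancel_right]

variable (A) in
/-- The inverse homomorphism. -/
noncomputable def fiberHom :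
    OneFiber (epsilon A) ⧸ C (epsilon A) →* Multiplicative (EndClass.Group A) :=
  QuotientGroup.lift _
    (MonoidHom.mk' (fun u => Multiplicative.ofAdd (rationalClass (ofLoc A (u : (PolyLoc A)ˣ))))
      fun u v => by
        have hu : epsilon A (u : (PolyLoc A)ˣ) = 1 := congrArg Units.val u.2
        have hv : epsilon A (v : (PolyLoc A)ˣ) = 1 := congrArg Units.val v.2
        rw [← ofAdd_add, ← rationalClass_mul, ← map_mul]
        · rfl
        · rw [augmentation_ofLoc, hu]
        · rw [augmentation_ofLoc, hv])
    (by
      rw [C, Subgroup.closure_le]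
      rintro _ ⟨a, b, hab, hba, p, q, hp, hq, rfl⟩
      rw [SetLike.mem_coe, MonoidHom.mem_ker, map_mul, map_inv, mul_inv_eq_one]
      refine congrArg Multiplicative.ofAdd ?_
      -- The kernel condition on a generator of `C` is the symmetry of `rationalClass` between `1 +
      -- ab` and `1 + ba`.
      rw [hp, hq, map_add, map_add, map_mul, map_mul, map_one]
      refine rationalClass_one_add_mul_comm ?_ ?_
      · rw [← map_mul, augmentation_ofLoc, hab]
      · rw [← map_mul, augmentation_ofLoc, hba])

theorem fiberHom_elemClass {b : PolyLoc A} (hb : epsilon A b = 1) :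
    fiberHom A (elemClass (epsilon A) b) = Multiplicative.ofAdd (rationalClass (ofLoc A b)) := by
  rw [elemClass_eq hb]
  rfl

theorem charHom_fiberHom (x : OneFiber (epsilon A) ⧸ C (epsilon A)) :
    charHom A (fiberHom A x).toAdd = Additive.ofMul x := by
  obtain ⟨b, hb, rfl⟩ := exists_elemClass x
  rw [fiberHom_elemClass hb, toAdd_ofAdd, charHom_rationalClass hb]

theorem fiberHom_surjective (z : EndClass.Group A) :
    ∃ x : Additive (OneFiber (epsilon A) ⧸ C (epsilon A)), (fiberHom A x.toMul).toAdd = z := by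
  change z ∈ (MonoidHom.toAdditiveLeft (fiberHom A)).range
  refine mem_of_forall_cls_mem (fun n α => ?_) z
  have h := matCls_mem_of_rationalClass_mem (MonoidHom.toAdditiveLeft (fiberHom A)).range
    (fun b hb => ?_) (LinearMap.toMatrixRight' α)
  · rwa [matCls_fin, LinearEquiv.symm_apply_apply] at h
  · rw [← ofLoc_eval b] at hb ⊢
    rw [augmentation_ofLoc] at hb
    exact ⟨Additive.ofMul (elemClass (epsilon A) _), congrArg Multiplicative.toAdd
      (fiberHom_elemClass hb)⟩

/-- `fiberHom` is a right inverse of `charHom` and is itself onto, which gives injectivity as well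
as surjectivity. -/
theorem charHom_bijective : Function.Bijective (charHom A) := by
  constructor
  · intro y z hyz
    obtain ⟨y, rfl⟩ := fiberHom_surjective y
    obtain ⟨z, rfl⟩ := fiberHom_surjective z
    rw [charHom_fiberHom, charHom_fiberHom] at hyz
    rw [Additive.ofMul.injective hyz]
  · exact fun x => ⟨_, charHom_fiberHom x.toMul⟩

end PolynomialLocalization

theorem mainTheorem2 (A : Type*) [Ring A] :
    ∃ Φ : EndClass.Group A ≃+
        Additive (LocalAugmentation.OneFiber (PolynomialLocalization.epsilon A) ⧸
          LocalAugmentation.C (PolynomialLocalization.epsilon A)),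
      ∀ (n : ℕ) (α : Module.End A (Fin n → A)),
        Φ (EndClass.cls n α) =
          Additive.ofMul (LocalAugmentation.D (PolynomialLocalization.epsilon A) n
            (PolynomialLocalization.oneSubMulX α) (PolynomialLocalization.map_oneSubMulX α)) := by
  refine ⟨AddEquiv.ofBijective (PolynomialLocalization.charHom A)
    PolynomialLocalization.charHom_bijective, fun n α => ?_⟩
  rw [← PolynomialLocalization.charDet_eq]
  exact PolynomialLocalization.charHom_cls α
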